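/- **Setting.** Let $\mathcal M=(\mathcal S,\mathcal A,(p_h,\nu_h)_{h\in[H]},s_1,H)$ be an episodic MDP with finite state space ($S=|\mathcal S|$), finite non-empty action space ($A=|\mathcal A|$), horizon $H\ge 1$, initial state $s_1$, transition probabilities $p_h(\cdot\mid s,a)$ and reward distributions $\nu_h(s,a)$ supported on $[0,1]$ with means $r_h(s,a)$. $\Pi$ is the set of deterministic policies $\pi=(\pi_h)_{h\in[H]}$, $\pi_h:\mathcal S\to\mathcal A$. $V^\pi_h$ and $V_h^\star$ are given by $V^\pi_{H+1}=V^\star_{H+1}=0$, $V_h^\pi(s)=r_h(s,\pi_h(s))+\sum_{s'}p_h(s'\mid s,\pi_h(s))V^\pi_{h+1}(s')$, $V_h^\star(s)=\max_a\big(r_h(s,a)+\sum_{s'}p_h(s'\mid s,a)V^\star_{h+1}(s')\big)$. Let $p_h^\pi(s)=\mathbb P^\pi(s_h=s)$, $p_h^\pi(s,a)=p_h^\pi(s)\mathbf 1\{\pi_h(s)=a\}$, $$p_h^{\min}(s,a)=\min_{\pi\in\Pi:\,p_h^\pi(s,a)>0}p_h^\pi(s,a)\quad(=+\infty\text{ if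 no policy reaches }(s,a)\text{ at stage }h),\qquad p_{\min}=\min_{h,s,a}p_h^{\min}(s,a),$$ $$\widetilde\Delta_h(s,a)=\min_{\pi\in\Pi:\,p_h^\pi(s,a)>0}\ \max_{\ell\in[H]}\ \max_{s':\,p_\ell^\pi(s')>0}\big(V_\ell^\star(s')-V_\ell^\pi(s')\big).$$ **Algorithm BPI-UCRL.** Fix $\varepsilon>0$, $\delta\in(0,1)$ and let $\beta(n,\delta)=\big(\sqrt{\beta^r(n,\delta)}+\sqrt{2\beta^p(n,\delta)}\big)^2$, where $\beta^r(n,\delta)=\frac12\big(\log\frac{3SAH}{\delta}+\log(e(1+n))\big)$ and $\beta^p(n,\delta)=\log\frac{3SAH}{\delta}+(S-1)\log\big(e(1+\frac{n}{S-1})\big)$ (the last term is $0$ if $S=1$). After $t$ episodes let $n_h^t(s,a)$ be the number of visits to $(s,a)$ at stage $h$, let $\widehat r_h^t(s,a)$ and $\widehat p_h^t(s'\mid s,a)$ be the empirical mean reward and the empirical transition frequencies ($0$ if $n_h^t(s,a)=0$), and let $b_h^t(s,a)=(H-h+1)\Big(\sqrt{\beta(n_h^t(s,a),\delta)/n_h^t(s,a)}\wedge1\Big)$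 ($=H-h+1$ if $n_h^t(s,a)=0$). Put $\overline Q^t_{H+1}=\underline Q^t_{H+1}=0$ and, for $h\in[H]$, $$\overline Q_h^t(s,a)=\min\Big(H-h+1,\ \widehat r_h^t(s,a)+b_h^t(s,a)+\sum_{s'}\widehat p_h^t(s'\mid s,a)\max_{a'}\overline Q_{h+1}^t(s',a')\Big),$$ $$\underline Q_h^t(s,a)=\max\Big(0,\ \widehat r_h^t(s,a)-b_h^t(s,a)+\sum_{s'}\widehat p_h^t(s'\mid s,a)\max_{a'}\underline Q_{h+1}^t(s',a')\Big).$$ Episode $t+1$ is played with a policy $\pi^{t+1}_h(s)\in\arg\max_a\overline Q_h^t(s,a)$, the stopping time is $\tau=\inf\{t\in\mathbb N:\max_a\overline Q_1^t(s_1,a)-\max_a\underline Q_1^t(s_1,a)\le\varepsilon\}$, and the recommendation is a policy $\widehat\pi^\tau_h(s)\in\arg\max_a\underline Q_h^\tau(s,a)$ (ties are broken arbitrarily). **Theorem.** With probability at least $1-\delta$, BPI-UCRL stops ($\tau<\infty$), every recommended policy satisfies $V_1^{\widehat\pi^\tau}(s_1)\ge V_1^\star(s_1)-\varepsilon$, and,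 if $\varepsilon\le H$, $$\tau\ \le\ H^4\sum_{h=1}^H\sum_{s\in\mathcal S}\sum_{a\in\mathcal A}\frac{720\log\frac{3SAH}{\delta}+1729\,S\log\Big(1152\,\frac{S^2AH^5}{p_{\min}\varepsilon^2}\log\frac{3SAH}{\delta}\Big)}{p_h^{\min}(s,a)\,\max\{\widetilde\Delta_h(s,a),\varepsilon\}^2},$$ where the terms with $p_h^{\min}(s,a)=+\infty$ are $0$. -/

import Mathlib

open MeasureTheory

/-- A finite-horizon episodic MDP with finite state space `S`, finite action space `A`, horizon `H`,
initial state `start`, transition probabilities `p h s a s'`, and reward distributions `ν h s a`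
supported on `[0,1]`. Stages are indexed from `0`: the index `h : Fin H` is the `(h+1)`-th stage. -/
structure EpisodicMDP (S A : Type*) [Fintype S] (H : ℕ) where
  start : S
  p : Fin H → S → A → S → ℝ
  p_nonneg : ∀ h s a s', 0 ≤ p h s a s'
  p_sum : ∀ h s a, ∑ s', p h s a s' = 1
  ν : Fin H → S → A → Measure ℝ
  ν_prob : ∀ h s a, IsProbabilityMeasure (ν h s a)
  ν_supp : ∀ h s a, ν h s a (Set.Icc 0 1)ᶜ = 0

/-- Deterministic (Markov, stage-dependent) policies. -/
abbrev Policy (S A : Type*) (H : ℕ) : Type _ := Fin H → S → A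

/-- The record of one episode: the states `s_1, …, s_{H+1}`, the actions `a_1, …, a_H` and the
rewards `r_1, …, r_H`. -/
abbrev Episode (S A : Type*) (H : ℕ) : Type _ := (Fin (H + 1) → S) × (Fin H → A) × (Fin H → ℝ)

/-- Backward recursion: value `0` after the last stage, and `step h W` at stage `h` if the values at
the next stage are `W`. -/
def backward {S : Type*} {H : ℕ} (step : Fin H → (S → ℝ) → S → ℝ) : Fin (H + 1) → S → ℝ :=
  fun i => Fin.reverseInduction (motive := fun _ => S → ℝ) (fun _ => 0) (fun h W => step h W) i

theorem backward_last {S : Type*} {H : ℕ} (step : Fin H → (S → ℝ) → S → ℝ) :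
    backward step (Fin.last H) = fun _ => 0 := by
  simp [backward]

theorem backward_castSucc {S : Type*} {H : ℕ} (step : Fin H → (S → ℝ) → S → ℝ) (h : Fin H) :
    backward step h.castSucc = step h (backward step h.succ) := by
  simp [backward]

namespace EpisodicMDP

noncomputable section

variable {S A : Type*} [Fintype S] {H : ℕ}

/-- Expected reward `r_h(s,a)`. -/
def r (M : EpisodicMDP S A H) (h : Fin H) (s : S) (a : A) : ℝ := ∫ x, x ∂(M.ν h s a)

/-- `V_h^π(s)`, for `h = 1, …, H+1`. -/
def V (M : EpisodicMDP S A H) (π : Policy S A H) : Fin (H + 1) → S → ℝ :=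
  backward fun h W s => M.r h s (π h s) + ∑ s', M.p h s (π h s) s' * W s'

/-- The optimal value function `V_h^⋆(s)`, for `h = 1, …, H+1`. -/
def Vstar (M : EpisodicMDP S A H) : Fin (H + 1) → S → ℝ :=
  backward fun h W s => ⨆ a, (M.r h s a + ∑ s', M.p h s a s' * W s')

/-- Probability that the states of an episode played with `π` are `σ`. -/
def pathProb [DecidableEq S] (M : EpisodicMDP S A H) (π : Policy S A H) (σ : Fin (H + 1) → S) : ℝ :=
  if σ 0 = M.start then ∏ h : Fin H, M.p h (σ h.castSucc) (π h (σ h.castSucc)) (σ h.succ) else 0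

/-- The law `ℙ^π` of one episode played with `π`: the states follow the Markov chain started at
`M.start`, the actions are `a_h = π_h(s_h)`, and given the states the rewards are independent with
`r_h ∼ ν_h(s_h, a_h)`. -/
def episodeLaw [DecidableEq S] [MeasurableSpace S] [MeasurableSpace A]
    (M : EpisodicMDP S A H) (π : Policy S A H) : Measure (Episode S A H) :=
  ∑ σ : Fin (H + 1) → S, ENNReal.ofReal (M.pathProb π σ) •
    (Measure.dirac σ).prod ((Measure.dirac fun h => π h (σ h.castSucc)).prod
      (Measure.pi fun h => M.ν h (σ h.castSucc) (π h (σ h.castSucc))))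

section Complexity

variable [DecidableEq S] [DecidableEq A] [MeasurableSpace S] [MeasurableSpace A]

/-- `p_h^π(s) = ℙ^π(s_h = s)`. -/
def stateProb (M : EpisodicMDP S A H) (π : Policy S A H) (h : Fin H) (s : S) : ℝ :=
  (M.episodeLaw π).real {x | x.1 h.castSucc = s}

/-- `p_h^π(s,a) = p_h^π(s) 𝟙{π_h(s) = a}`. -/
def visitProb (M : EpisodicMDP S A H) (π : Policy S A H) (h : Fin H) (s : S) (a : A) : ℝ :=
  if π h s = a then M.stateProb π h s else 0

/-- `p_h^min(s,a)`: the least positive visitation probability of `(s,a)` at stage `h`; it is `∞` if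
no policy reaches the triplet. -/
def minVisit (M : EpisodicMDP S A H) (h : Fin H) (s : S) (a : A) : ENNReal :=
  ⨅ (π : Policy S A H) (_ : 0 < M.visitProb π h s a), ENNReal.ofReal (M.visitProb π h s a)

/-- `p_min`: the minimum of `p_h^min(s,a)` over all triplets. -/
def pMin (M : EpisodicMDP S A H) : ℝ := (⨅ (h : Fin H) (s : S) (a : A), M.minVisit h s a).toReal

/-- The conditional return gap of `(s,a)` at stage `h` (only meaningful for reachable triplets, where
the minimum is over a non-empty set). -/
def condReturnGap (M : EpisodicMDP S A H) (h : Fin H) (s : S) (a : A) : ℝ :=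
  ⨅ π : {π : Policy S A H // 0 < M.visitProb π h s a},
    ⨆ q : {q : Fin H × S // 0 < M.stateProb π.1 q.1 q.2},
      (M.Vstar q.1.1.castSucc q.1.2 - M.V π.1 q.1.1.castSucc q.1.2)

end Complexity

end

end EpisodicMDP

namespace BPIUCRL

noncomputable section

/-- Reward threshold `β^r(n,δ)`. -/
def betaR (S A H : ℕ) (δ : ℝ) (n : ℕ) : ℝ :=
  1 / 2 * (Real.log (3 * S * A * H / δ) + Real.log (Real.exp 1 * (1 + n)))

/-- Transition (KL) threshold `β^p(n,δ)`; the second term is `0` if `S = 1`. -/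
def betaP (S A H : ℕ) (δ : ℝ) (n : ℕ) : ℝ :=
  Real.log (3 * S * A * H / δ) +
    ((S : ℝ) - 1) * Real.log (Real.exp 1 * (1 + n / ((S : ℝ) - 1)))

/-- The threshold `β(n,δ) = (√β^r + √(2 β^p))²`. -/
def beta (S A H : ℕ) (δ : ℝ) (n : ℕ) : ℝ :=
  (Real.sqrt (betaR S A H δ n) + Real.sqrt (2 * betaP S A H δ n)) ^ 2

variable {S A : Type*} {H : ℕ}

section Estimates

variable [DecidableEq S] [DecidableEq A]

/-- `n_h^t(s,a)`: number of visits to `(s,a)` at stage `h` in the first `t` episodes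
`x 0, …, x (t-1)`. -/
def count (x : ℕ → Episode S A H) (t : ℕ) (h : Fin H) (s : S) (a : A) : ℕ :=
  ∑ j ∈ Finset.range t, if (x j).1 h.castSucc = s ∧ (x j).2.1 h = a then 1 else 0

/-- Empirical mean reward; it is `0` if there is no visit. -/
def rHat (x : ℕ → Episode S A H) (t : ℕ) (h : Fin H) (s : S) (a : A) : ℝ :=
  (∑ j ∈ Finset.range t, if (x j).1 h.castSucc = s ∧ (x j).2.1 h = a then (x j).2.2 h else 0) /
    count x t h s a

/-- Empirical transition probabilities; they are `0` if there is no visit. -/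
def pHat (x : ℕ → Episode S A H) (t : ℕ) (h : Fin H) (s : S) (a : A) (s' : S) : ℝ :=
  (∑ j ∈ Finset.range t,
    if (x j).1 h.castSucc = s ∧ (x j).2.1 h = a ∧ (x j).1 h.succ = s' then (1 : ℝ) else 0) /
    count x t h s a

/-- The bonus `b_h^t(s,a)` for a threshold function `β`. With stages indexed from `0`, the factor
`H - h + 1` becomes `H - h`. Without any visit the square root is `∞`, so its minimum with `1` is
`1`. -/
def bonus (β : ℕ → ℝ) (x : ℕ → Episode S A H) (t : ℕ) (h : Fin H) (s : S) (a : A) : ℝ :=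
  ((H : ℝ) - (h : ℕ)) *
    (if count x t h s a = 0 then 1
      else min (Real.sqrt (β (count x t h s a) / count x t h s a)) 1)

variable [Fintype S]

/-- `min (H-h+1, r̂ + b + ∑ p̂ W)` (stages indexed from `0`). -/
def upperStep (β : ℕ → ℝ) (x : ℕ → Episode S A H) (t : ℕ) (h : Fin H) (W : S → ℝ)
    (s : S) (a : A) : ℝ :=
  min ((H : ℝ) - (h : ℕ))
    (rHat x t h s a + bonus β x t h s a + ∑ s', pHat x t h s a s' * W s')

/-- `max (0, r̂ - b + ∑ p̂ W)`. -/
def lowerStep (β : ℕ → ℝ) (x : ℕ → Episode S A H) (t : ℕ) (h : Fin H) (W : S → ℝ)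
    (s : S) (a : A) : ℝ :=
  max 0 (rHat x t h s a - bonus β x t h s a + ∑ s', pHat x t h s a s' * W s')

/-- The upper bound on the optimal values after `t` episodes, `max_a` of the upper `Q`-bound. -/
def upperV (β : ℕ → ℝ) (x : ℕ → Episode S A H) (t : ℕ) : Fin (H + 1) → S → ℝ :=
  backward fun h W s => ⨆ a, upperStep β x t h W s a

/-- The lower bound on the optimal values after `t` episodes, `max_a` of the lower `Q`-bound. -/
def lowerV (β : ℕ → ℝ) (x : ℕ → Episode S A H) (t : ℕ) : Fin (H + 1) → S → ℝ :=
  backward fun h W s => ⨆ a, lowerStep β x t h W s a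

/-- The upper bound on `Q_h^⋆(s,a)` after `t` episodes. -/
def upperQ (β : ℕ → ℝ) (x : ℕ → Episode S A H) (t : ℕ) (h : Fin H) (s : S) (a : A) : ℝ :=
  upperStep β x t h (upperV β x t h.succ) s a

/-- The lower bound on `Q_h^⋆(s,a)` after `t` episodes. -/
def lowerQ (β : ℕ → ℝ) (x : ℕ → Episode S A H) (t : ℕ) (h : Fin H) (s : S) (a : A) : ℝ :=
  lowerStep β x t h (lowerV β x t h.succ) s a

end Estimates

/-- `π_h(s) ∈ argmax_a Q_h(s,a)` for all `h` and `s`. -/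
def IsGreedy (Q : Fin H → S → A → ℝ) (π : Policy S A H) : Prop :=
  ∀ h s a, Q h s a ≤ Q h s (π h s)

/-- The stopping time `τ`, the least `t` such that after `t` episodes the difference of the upper and
the lower bound on the value of `s₁` at the first stage is at most `ε` (`∞` if there is none). -/
def stoppingTime [Fintype S] [DecidableEq S] [DecidableEq A] (β : ℕ → ℝ) (s₁ : S) (ε : ℝ)
    (x : ℕ → Episode S A H) : ℕ∞ :=
  ⨅ (t : ℕ) (_ : upperV β x t 0 s₁ - lowerV β x t 0 s₁ ≤ ε), (t : ℕ∞)

/-- A run of the BPI-UCRL sampling rule in the MDP `M`. Episodes are counted from `0`: `π t` and `x t`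
are the policy and the record of the `(t+1)`-th episode, and `F t` is the information available after
`t` episodes. Given this information, the next episode has the law `ℙ^π` with `π = π t`, and `π t` is
greedy for the upper `Q`-bounds, with ties broken in any non-anticipating way. -/
structure IsRun [Fintype S] [DecidableEq S] [DecidableEq A] [MeasurableSpace S] [MeasurableSpace A]
    {Ω : Type*} [mΩ : MeasurableSpace Ω] (M : EpisodicMDP S A H) (β : ℕ → ℝ) (μ : Measure Ω)
    (F : Filtration ℕ mΩ) (π : ℕ → Ω → Policy S A H) (x : ℕ → Ω → Episode S A H) : Prop where
  measurable_policy : ∀ t, Measurable[F t] (π t)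
  measurable_episode : ∀ t, Measurable[F (t + 1)] (x t)
  law_episode : ∀ t E, MeasurableSet[F t] E → ∀ B, MeasurableSet B →
    μ (E ∩ x t ⁻¹' B) = ∫⁻ ω in E, M.episodeLaw (π t ω) B ∂μ
  greedy : ∀ t ω, IsGreedy (upperQ β (fun j => x j ω) t) (π t ω)

end

end BPIUCRL

/-! The proof is deterministic on a good event `IsGood` of probability at least `1 - δ`. On it, at
all times, empirical rewards and transitions are within a relative width of the truth (`Accurate`),
and half of the accumulated visitation probabilities exceeds the visit counts by at most `L`.

Probability of the good event. Each requirement comes from products of factors, one per episode,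
whose mean under `ℙ^ϖ` is at most one for every policy `ϖ`; such products are nonnegative
supermartingales along a run, and Ville's inequality bounds them at all times at once. For rewards
and transitions the factors come from Hoeffding's lemma, with exponents on a dyadic grid
(`measure_deviation_le`). Transition errors are tested on all `2^S` sets of states, which by
`abs_sum_mul_le` controls them on every function with values in `[0, K]`. The threshold `β` is large
enough for this union bound (`deviation_level_le_beta`), so no Kullback-Leibler concentration is
needed.

Correctness. On the good event the bounds bracket: `V⋆ ≤ upperV` by optimism, and `lowerV ≤ V^π̂`
for every `π̂` greedy for the lower bounds. When the rule fires the two differ by at most `ε` at the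
start.

Sample complexity. For the played policy `π`, both `upperV - lowerV` and `upperV - V^π` satisfy a
recursion along `π` with local cost at most `3 (H - h)` widths. If `κ` is the largest width at a
state that `π` reaches, both are at most `3 H² κ` at reachable states. The widest reachable triplet
of an unstopped episode therefore satisfies `max (gap, ε) ≤ 3 H² κ`
(`Accurate.exists_wide_triplet`), and the episode is charged to it. At the last episode charged to a
triplet its width is still large, so its count `n` is at most `9 H⁴ β(n) / max (gap, ε)²`; every
charged episode visits it with probability at least `p^min`, so the number of charges times `p^min`
is at most `2 (n + L) + 1`. The logarithm of `n` inside `β(n)` is removed by self-bounding, and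
summing over triplets bounds every `N` before which the rule has not fired. This gives termination
as well as the rate. -/

/-! ### Finite path sums of an inhomogeneous Markov chain. -/

section MarkovPaths

variable {S : Type*} [Fintype S] [DecidableEq S]

/-- Sum of `f` over the paths started at `s₀`, weighted by the kernels `K`. -/
def pathSum {n : ℕ} (K : Fin n → S → S → ℝ) (s₀ : S) (f : (Fin (n + 1) → S) → ℝ) : ℝ :=
  ∑ σ : Fin (n + 1) → S,
    (if σ 0 = s₀ then ∏ h : Fin n, K h (σ h.castSucc) (σ h.succ) else 0) * f σ

theorem pathSum_zero (K : Fin 0 → S → S → ℝ) (s₀ : S) (f : (Fin 1 → S) → ℝ) :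
    pathSum K s₀ f = f fun _ => s₀ := by
  unfold pathSum
  rw [Finset.sum_eq_single (fun _ => s₀)]
  · simp
  · intro σ _ hσ
    have : σ 0 ≠ s₀ := fun h => hσ (by ext i; rw [Fin.fin_one_eq_zero i, h])
    simp [this]
  · simp

/-- First-step decomposition, the engine of the inductions on the length of the path. -/
theorem pathSum_succ {n : ℕ} (K : Fin (n + 1) → S → S → ℝ) (s₀ : S)
    (f : (Fin (n + 2) → S) → ℝ) :
    pathSum K s₀ f = ∑ s₁, K 0 s₀ s₁ *
      pathSum (fun h => K h.succ) s₁ (fun τ => f (Fin.cons s₀ τ)) := by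
  unfold pathSum
  rw [← (Fin.consEquiv (fun _ : Fin (n + 2) => S)).sum_comp, Fintype.sum_prod_type,
    Finset.sum_eq_single s₀]
  · simp_rw [Finset.mul_sum]
    rw [Finset.sum_comm]
    refine Finset.sum_congr rfl fun τ _ => ?_
    rw [Finset.sum_eq_single (τ 0)]
    · simp [Fin.consEquiv, Fin.prod_univ_succ, mul_assoc]
    · intro s₁ _ h
      simp [Ne.symm h]
    · simp
  · intro s _ hs
    simp [Fin.consEquiv, hs]
  · simp

theorem pathSum_one {n : ℕ} (K : Fin n → S → S → ℝ) (hK : ∀ h s, ∑ s', K h s s' = 1) (s₀ : S) :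
    pathSum K s₀ (fun _ => 1) = 1 := by
  induction n generalizing s₀ with
  | zero => rw [pathSum_zero]
  | succ n ih =>
    rw [pathSum_succ]
    simp_rw [ih (fun h => K h.succ) (fun h => hK h.succ), mul_one, hK]

theorem pathSum_const {n : ℕ} (K : Fin n → S → S → ℝ) (hK : ∀ h s, ∑ s', K h s s' = 1) (s₀ : S)
    (c : ℝ) : pathSum K s₀ (fun _ => c) = c := by
  have := pathSum_one K hK s₀
  simp only [pathSum, mul_one] at this
  simp only [pathSum, ← Finset.sum_mul, this, one_mul]

/-- The Markov property: the state at time `h + 1` may be averaged out given the state at time `h`. -/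
theorem pathSum_markov {n : ℕ} (K : Fin n → S → S → ℝ) (hK : ∀ h s, ∑ s', K h s s' = 1) (s₀ : S)
    (h : Fin n) (φ : S → S → ℝ) :
    pathSum K s₀ (fun σ => φ (σ h.castSucc) (σ h.succ)) =
      pathSum K s₀ (fun σ => ∑ s', K h (σ h.castSucc) s' * φ (σ h.castSucc) s') := by
  induction n generalizing s₀ with
  | zero => exact h.elim0
  | succ n ih =>
    rw [pathSum_succ, pathSum_succ]
    induction h using Fin.cases with
    | zero =>
      simp only [Fin.castSucc_zero, Fin.cons_zero, Fin.cons_succ]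
      simp_rw [pathSum_const (fun h => K (Fin.succ h)) (fun h => hK h.succ)]
      rw [← Finset.sum_mul, hK, one_mul]
      refine Finset.sum_congr rfl fun s₁ _ => ?_
      congr 1
      -- It remains to see that a path sum started at `s₁` evaluates a function of the first state
      -- at `s₁`; one more unfolding shows it.
      rcases n with _ | n
      · rw [pathSum_zero]
      · rw [pathSum_succ]
        simp only [Fin.cons_zero]
        simp_rw [pathSum_const (fun h => K (Fin.succ (Fin.succ h))) (fun h => hK h.succ.succ)]
        rw [← Finset.sum_mul, hK, one_mul]
    | succ h =>
      refine Finset.sum_congr rfl fun s₁ _ => ?_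
      congr 1
      simpa using ih (fun h => K h.succ) (fun h => hK h.succ) s₁ h

end MarkovPaths

/-! ### The law of an episode as a path sum. -/

namespace EpisodicMDP

theorem measurableSet_state {S A : Type*} {H : ℕ} [MeasurableSpace S] [MeasurableSpace A]
    [MeasurableSingletonClass S] (h : Fin (H + 1)) (s : S) :
    MeasurableSet {x : Episode S A H | x.1 h = s} :=
  ((measurable_pi_apply (X := fun _ : Fin (H + 1) => S) h).comp
    measurable_fst) (measurableSet_singleton s)

variable {S A : Type*} [Fintype S] {H : ℕ} (M : EpisodicMDP S A H)

instance instIsProbabilityMeasureReward (h : Fin H) (s : S) (a : A) :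
    IsProbabilityMeasure (M.ν h s a) := M.ν_prob h s a

section Paths

variable [DecidableEq S]

theorem pathProb_nonneg (π : Policy S A H) (σ : Fin (H + 1) → S) : 0 ≤ M.pathProb π σ := by
  unfold pathProb
  split_ifs
  · exact Finset.prod_nonneg fun h _ => M.p_nonneg _ _ _ _
  · exact le_rfl

theorem sum_pathProb_mul (π : Policy S A H) (f : (Fin (H + 1) → S) → ℝ) :
    ∑ σ, M.pathProb π σ * f σ = pathSum (fun h s s' => M.p h s (π h s) s') M.start f := rfl

theorem sum_pathProb (π : Policy S A H) : ∑ σ, M.pathProb π σ = 1 := by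
  have := pathSum_one (fun h s s' => M.p h s (π h s) s') (fun h s => M.p_sum h s _) M.start
  rw [← M.sum_pathProb_mul] at this
  simpa using this

theorem sum_pathProb_markov (π : Policy S A H) (h : Fin H) (φ : S → S → ℝ) :
    ∑ σ, M.pathProb π σ * φ (σ h.castSucc) (σ h.succ) =
      ∑ σ, M.pathProb π σ * ∑ s', M.p h (σ h.castSucc) (π h (σ h.castSucc)) s' *
        φ (σ h.castSucc) s' :=
  pathSum_markov (fun h s s' => M.p h s (π h s) s') (fun h s => M.p_sum h s _) M.start h φ

theorem sum_ofReal_pathProb (π : Policy S A H) :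
    ∑ σ, ENNReal.ofReal (M.pathProb π σ) = 1 := by
  rw [← ENNReal.ofReal_sum_of_nonneg fun σ _ => M.pathProb_nonneg π σ, M.sum_pathProb,
    ENNReal.ofReal_one]

variable [MeasurableSpace S] [MeasurableSpace A]

theorem lintegral_episodeLaw (π : Policy S A H) {f : Episode S A H → ENNReal} (hf : Measurable f) :
    ∫⁻ x, f x ∂(M.episodeLaw π) = ∑ σ, ENNReal.ofReal (M.pathProb π σ) *
      ∫⁻ ρ, f (σ, (fun h => π h (σ h.castSucc)), ρ)
        ∂(Measure.pi fun h => M.ν h (σ h.castSucc) (π h (σ h.castSucc))) := by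
  unfold episodeLaw
  rw [lintegral_finsetSum_measure]
  refine Finset.sum_congr rfl fun σ _ => ?_
  rw [lintegral_smul_measure, smul_eq_mul, Measure.dirac_prod, Measure.dirac_prod,
    lintegral_map hf (by fun_prop), lintegral_map (by fun_prop) (by fun_prop)]

/-- Integrands that ignore the rewards reduce to finite sums over paths, where the Markov property
applies. -/
theorem lintegral_episodeLaw_states [MeasurableSingletonClass S] (π : Policy S A H)
    {g : (Fin (H + 1) → S) → ℝ} (hg : ∀ σ, 0 ≤ g σ) {f : Episode S A H → ENNReal}
    (hf : Measurable f)
    (hfg : ∀ σ ρ, f (σ, (fun h => π h (σ h.castSucc)), ρ) = ENNReal.ofReal (g σ)) :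
    ∫⁻ x, f x ∂(M.episodeLaw π) = ENNReal.ofReal (∑ σ, M.pathProb π σ * g σ) := by
  rw [M.lintegral_episodeLaw π hf, ENNReal.ofReal_sum_of_nonneg
    fun σ _ => mul_nonneg (M.pathProb_nonneg π σ) (hg σ)]
  refine Finset.sum_congr rfl fun σ _ => ?_
  simp only [hfg, lintegral_const, measure_univ, mul_one]
  rw [ENNReal.ofReal_mul (M.pathProb_nonneg π σ)]

/-- Marginalisation of the rewards: a function of the states and of the reward at stage `h`. -/
theorem lintegral_episodeLaw_reward (π : Policy S A H) (h : Fin H)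
    {f : Episode S A H → ENNReal} (hf : Measurable f)
    (g : (Fin (H + 1) → S) → ℝ → ENNReal) (hg : ∀ σ, Measurable (g σ))
    (hfg : ∀ σ ρ, f (σ, (fun h => π h (σ h.castSucc)), ρ) = g σ (ρ h)) :
    ∫⁻ x, f x ∂(M.episodeLaw π) = ∑ σ, ENNReal.ofReal (M.pathProb π σ) *
      ∫⁻ y, g σ y ∂(M.ν h (σ h.castSucc) (π h (σ h.castSucc))) := by
  rw [M.lintegral_episodeLaw π hf]
  refine Finset.sum_congr rfl fun σ _ => ?_
  simp only [hfg]
  congr 1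
  exact (measurePreserving_eval
    (fun h => M.ν h (σ h.castSucc) (π h (σ h.castSucc))) h).lintegral_comp (hg σ)

instance isProbabilityMeasure_episodeLaw (π : Policy S A H) :
    IsProbabilityMeasure (M.episodeLaw π) := by
  constructor
  rw [← lintegral_one, M.lintegral_episodeLaw π measurable_const]
  simp [M.sum_ofReal_pathProb]

theorem stateProb_nonneg (π : Policy S A H) (h : Fin H) (s : S) : 0 ≤ M.stateProb π h s :=
  measureReal_nonneg

theorem stateProb_le_one (π : Policy S A H) (h : Fin H) (s : S) : M.stateProb π h s ≤ 1 :=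
  measureReal_le_one

variable [MeasurableSingletonClass S]

theorem stateProb_eq_sum (π : Policy S A H) (h : Fin H) (s : S) :
    M.stateProb π h s = ∑ σ, M.pathProb π σ * if σ h.castSucc = s then 1 else 0 := by
  have hm := measurableSet_state (S := S) (A := A) (H := H) h.castSucc s
  unfold stateProb Measure.real
  rw [← lintegral_indicator_one hm, M.lintegral_episodeLaw_states π
    (g := fun σ => if σ h.castSucc = s then 1 else 0), ENNReal.toReal_ofReal]
  · exact Finset.sum_nonneg fun σ _ =>
      mul_nonneg (M.pathProb_nonneg π σ) (by split_ifs <;> norm_num)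
  · intro σ
    positivity
  · exact measurable_one.indicator hm
  · intro σ ρ
    by_cases hs : σ h.castSucc = s <;> simp [Set.indicator, hs]

theorem stateProb_start (hH : 0 < H) (π : Policy S A H) :
    M.stateProb π ⟨0, hH⟩ M.start = 1 := by
  rw [M.stateProb_eq_sum]
  refine Eq.trans (Finset.sum_congr rfl fun σ _ => ?_) (M.sum_pathProb π)
  unfold pathProb
  have : (⟨0, hH⟩ : Fin H).castSucc = 0 := rfl
  rw [this]
  by_cases h0 : σ 0 = M.start <;> simp [h0]

/-- Reachability propagates along transitions of positive probability. -/
theorem stateProb_pos_of_transition (π : Policy S A H) (h h' : Fin H)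
    (hh : h.succ = h'.castSucc) (s s' : S)
    (hs : 0 < M.stateProb π h s) (hp : 0 < M.p h s (π h s) s') : 0 < M.stateProb π h' s' := by
  -- With the indicator of the pair `(s, s')` as test function, the Markov property gives the joint
  -- probability as `ℙ(s_h = s) p(s' | s)`.
  have key := M.sum_pathProb_markov π h
    (fun u v => (if u = s then 1 else 0) * if v = s' then 1 else 0)
  have h1 : ∑ σ, M.pathProb π σ * ((if σ h.castSucc = s then (1 : ℝ) else 0) *
      if σ h.succ = s' then 1 else 0) ≤ M.stateProb π h' s' := by
    rw [M.stateProb_eq_sum]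
    refine Finset.sum_le_sum fun σ _ => mul_le_mul_of_nonneg_left ?_ (M.pathProb_nonneg π σ)
    rw [hh]
    split_ifs <;> simp
  refine lt_of_lt_of_le ?_ h1
  rw [key]
  have h2 : ∑ σ, M.pathProb π σ * ∑ v, M.p h (σ h.castSucc) (π h (σ h.castSucc)) v *
      ((if σ h.castSucc = s then (1 : ℝ) else 0) * if v = s' then 1 else 0) =
      M.stateProb π h s * M.p h s (π h s) s' := by
    rw [M.stateProb_eq_sum, Finset.sum_mul]
    refine Finset.sum_congr rfl fun σ _ => ?_
    by_cases hσ : σ h.castSucc = s <;> simp [hσ]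
  rw [h2]
  positivity

end Paths

end EpisodicMDP

/-! ### Ville's maximal inequality. -/

/-- Ville's inequality for nonnegative supermartingales, in `ENNReal`. -/
theorem measure_exists_le_of_setLIntegral_le {Ω : Type*} {mΩ : MeasurableSpace Ω}
    (μ : Measure Ω) (F : Filtration ℕ mΩ) (W : ℕ → Ω → ENNReal)
    (hW : ∀ t, Measurable[F t] (W t))
    (hle : ∀ t E, MeasurableSet[F t] E → ∫⁻ ω in E, W (t + 1) ω ∂μ ≤ ∫⁻ ω in E, W t ω ∂μ)
    (c : ENNReal) :
    c * μ {ω | ∃ t, c ≤ W t ω} ≤ ∫⁻ ω, W 0 ω ∂μ := by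
  set hit : ℕ → Set Ω := fun n => {ω | ∃ t ≤ n, c ≤ W t ω} with hhit
  have hm1 : ∀ t, MeasurableSet[F t] {ω | c ≤ W t ω} := fun t => hW t measurableSet_Ici
  have hsucc : ∀ n, hit (n + 1) = hit n ∪ ((hit n)ᶜ ∩ {ω | c ≤ W (n + 1) ω}) := by
    intro n
    ext ω
    simp only [hhit, Set.mem_union, Set.mem_inter_iff, Set.mem_compl_iff, Set.mem_ofPred_eq]
    constructor
    · rintro ⟨t, ht, h⟩
      by_cases h' : ∃ t ≤ n, c ≤ W t ω
      · exact Or.inl h'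
      · refine Or.inr ⟨h', ?_⟩
        rcases Nat.lt_or_ge n t with h1 | h1
        · rwa [show n + 1 = t by omega]
        · exact (h' ⟨t, h1, h⟩).elim
    · rintro (⟨t, ht, h⟩ | ⟨-, h⟩)
      · exact ⟨t, by omega, h⟩
      · exact ⟨n + 1, le_rfl, h⟩
  have hmeas : ∀ n, MeasurableSet[F n] (hit n) := by
    intro n
    have : hit n = ⋃ t ∈ Set.Iic n, {ω | c ≤ W t ω} := by
      ext ω; simp [hhit]
    rw [this]
    exact MeasurableSet.biUnion (Set.to_countable _) fun t ht => F.mono ht _ (hm1 t)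
  -- This is the process stopped on reaching level `c`: hit paths contribute `c`, the others their
  -- current value. The supermartingale property is used only off the hit set, which is known at
  -- time `n`.
  have key : ∀ n, c * μ (hit n) + ∫⁻ ω in (hit n)ᶜ, W n ω ∂μ ≤ ∫⁻ ω, W 0 ω ∂μ := by
    intro n
    induction n with
    | zero =>
      have h0 : hit 0 = {ω | c ≤ W 0 ω} := by ext ω; simp [hhit]
      rw [← lintegral_add_compl (μ := μ) (W 0) (F.le 0 _ (hmeas 0))]
      gcongr
      rw [← setLIntegral_const]
      refine setLIntegral_mono_ae (((hW 0).mono (F.le 0) le_rfl).aemeasurable) ?_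
      refine Filter.Eventually.of_forall fun ω hω => ?_
      rw [h0] at hω
      exact hω
    | succ n ih =>
      refine le_trans ?_ ih
      have hA : MeasurableSet (hit n) := F.le n _ (hmeas n)
      have hB : MeasurableSet {ω | c ≤ W (n + 1) ω} := F.le _ _ (hm1 (n + 1))
      have hcompl : (hit (n + 1))ᶜ = (hit n)ᶜ \ {ω | c ≤ W (n + 1) ω} := by
        rw [hsucc]; ext ω; simp; tauto
      rw [hcompl, hsucc, measure_union
        (Set.disjoint_left.2 fun ω h1 h2 => h2.1 h1) (hA.compl.inter hB), mul_add, add_assoc]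
      gcongr
      refine le_trans ?_ (hle n _ (hmeas n).compl)
      rw [← lintegral_inter_add_sdiff (W (n + 1)) (hit n)ᶜ hB]
      gcongr
      rw [← setLIntegral_const]
      refine setLIntegral_mono_ae (((hW (n + 1)).mono (F.le _) le_rfl).aemeasurable) ?_
      exact Filter.Eventually.of_forall fun ω hω => hω.2
  have hU : {ω | ∃ t, c ≤ W t ω} = ⋃ n, hit n := by
    ext ω
    simp only [hhit, Set.mem_iUnion, Set.mem_ofPred_eq]
    exact ⟨fun ⟨t, h⟩ => ⟨t, t, le_rfl, h⟩, fun ⟨_, t, _, h⟩ => ⟨t, h⟩⟩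
  have hmono : Monotone hit := fun a b hab ω ⟨t, ht, h⟩ => ⟨t, ht.trans hab, h⟩
  rw [hU, hmono.measure_iUnion, ENNReal.mul_iSup]
  exact iSup_le fun n => le_trans le_self_add (key n)

/-! ### Supermartingales along a run of the algorithm. -/

namespace BPIUCRL

namespace IsRun

variable {S A : Type*} [Fintype S] [DecidableEq S] [DecidableEq A]
  [MeasurableSpace S] [MeasurableSpace A] [MeasurableSingletonClass A]
  {H : ℕ} {M : EpisodicMDP S A H} {β : ℕ → ℝ} {Ω : Type*} [mΩ : MeasurableSpace Ω]
  {μ : Measure Ω} {F : Filtration ℕ mΩ} {π : ℕ → Ω → Policy S A H}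
  {x : ℕ → Ω → Episode S A H}

theorem measurableSet_policy (hrun : IsRun M β μ F π x) (t : ℕ) (ϖ : Policy S A H) :
    MeasurableSet[F t] {ω | π t ω = ϖ} :=
  hrun.measurable_policy t (measurableSet_singleton ϖ)

variable [Finite A]

theorem measurable_increment (hrun : IsRun M β μ F π x) (t : ℕ)
    {f : Policy S A H → Episode S A H → ENNReal} (hf : ∀ ϖ, Measurable (f ϖ)) :
    Measurable[F (t + 1)] fun ω => f (π t ω) (x t ω) := by
  have h1 : Measurable fun q : Policy S A H × Episode S A H => f q.1 q.2 :=
    measurable_from_prod_countable_right hf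
  exact h1.comp (Measurable.prodMk ((hrun.measurable_policy t).mono (F.mono (Nat.le_succ t)) le_rfl)
    (hrun.measurable_episode t))

/-- If every `f ϖ` has mean at most one under `ℙ^ϖ`, so has `f (π t) (x t)`, conditionally on the
past. -/
theorem setLIntegral_increment_le (hrun : IsRun M β μ F π x) (t : ℕ)
    {f : Policy S A H → Episode S A H → ENNReal} (hf : ∀ ϖ, Measurable (f ϖ))
    (hf1 : ∀ ϖ, ∫⁻ y, f ϖ y ∂(M.episodeLaw ϖ) ≤ 1) {E : Set Ω} (hE : MeasurableSet[F t] E) :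
    ∫⁻ ω in E, f (π t ω) (x t ω) ∂μ ≤ μ E := by
  have hx : Measurable (x t) := (hrun.measurable_episode t).mono (F.le _) le_rfl
  have hEϖ : ∀ ϖ, MeasurableSet[F t] (E ∩ {ω | π t ω = ϖ}) :=
    fun ϖ => hE.inter (hrun.measurableSet_policy t ϖ)
  have hpiece : ∀ ϖ, ∫⁻ ω in E ∩ {ω | π t ω = ϖ}, f (π t ω) (x t ω) ∂μ ≤
      μ (E ∩ {ω | π t ω = ϖ}) := by
    intro ϖ
    -- On the part of the past where `ϖ` is played, the episode is independent of the past with law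
    -- `ℙ^ϖ`; there are only finitely many policies to sum over.
    have hmap : (μ.restrict (E ∩ {ω | π t ω = ϖ})).map (x t) =
        μ (E ∩ {ω | π t ω = ϖ}) • M.episodeLaw ϖ := by
      ext B hB
      rw [Measure.map_apply hx hB, Measure.restrict_apply (hx hB), Set.inter_comm,
        hrun.law_episode t _ (hEϖ ϖ) B hB, Measure.smul_apply, smul_eq_mul]
      rw [setLIntegral_congr_fun (g := fun _ => M.episodeLaw ϖ B) (F.le t _ (hEϖ ϖ))
        (fun ω hω => by simp only; rw [hω.2]), setLIntegral_const, mul_comm]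
    rw [setLIntegral_congr_fun (g := fun ω => f ϖ (x t ω)) (F.le t _ (hEϖ ϖ))
      (fun ω hω => by simp only; rw [hω.2]), ← lintegral_map (hf ϖ) hx, hmap,
      lintegral_smul_measure, smul_eq_mul]
    exact mul_le_of_le_one_right' (hf1 ϖ)
  have hcover : E = ⋃ ϖ, E ∩ {ω | π t ω = ϖ} := by
    ext ω; simp
  have hdisj : Pairwise (Function.onFun Disjoint fun ϖ => E ∩ {ω | π t ω = ϖ}) := by
    intro a b hab
    exact Set.disjoint_left.2 fun ω h1 h2 => hab (h1.2.symm.trans h2.2)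
  rw [hcover, lintegral_iUnion (fun ϖ => F.le t _ (hEϖ ϖ)) hdisj,
    measure_iUnion hdisj (fun ϖ => F.le t _ (hEϖ ϖ))]
  exact ENNReal.tsum_le_tsum hpiece

/-- Take the increment as a density. Restricted to the past, the resulting measure is dominated by
`μ`, and this comparison extends from events of the past to nonnegative functions of the past. -/
theorem lintegral_mul_increment_le (hrun : IsRun M β μ F π x) (t : ℕ)
    {f : Policy S A H → Episode S A H → ENNReal} (hf : ∀ ϖ, Measurable (f ϖ))
    (hf1 : ∀ ϖ, ∫⁻ y, f ϖ y ∂(M.episodeLaw ϖ) ≤ 1) {G : Ω → ENNReal}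
    (hG : Measurable[F t] G) {E : Set Ω} (hE : MeasurableSet[F t] E) :
    ∫⁻ ω in E, G ω * f (π t ω) (x t ω) ∂μ ≤ ∫⁻ ω in E, G ω ∂μ := by
  have hincr : Measurable fun ω => f (π t ω) (x t ω) :=
    (hrun.measurable_increment t hf).mono (F.le _) le_rfl
  have hG' : Measurable[F t] (E.indicator G) := hG.indicator hE
  set κ := μ.withDensity fun ω => f (π t ω) (x t ω) with hκ
  have htrim : κ.trim (F.le t) ≤ μ.trim (F.le t) := by
    refine Measure.le_intro fun E' hE' _ => ?_
    rw [trim_measurableSet_eq _ hE', trim_measurableSet_eq _ hE', hκ,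
      withDensity_apply _ (F.le t _ hE')]
    exact hrun.setLIntegral_increment_le t hf hf1 hE'
  have hEm := F.le t _ hE
  calc ∫⁻ ω in E, G ω * f (π t ω) (x t ω) ∂μ
      = ∫⁻ ω, E.indicator G ω ∂κ := by
        rw [hκ, lintegral_withDensity_eq_lintegral_mul _ hincr (hG'.mono (F.le t) le_rfl),
          ← lintegral_indicator hEm]
        refine lintegral_congr fun ω => ?_
        by_cases hω : ω ∈ E <;> simp [hω, mul_comm]
    _ = ∫⁻ ω, E.indicator G ω ∂(κ.trim (F.le t)) := (lintegral_trim _ hG').symm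
    _ ≤ ∫⁻ ω, E.indicator G ω ∂(μ.trim (F.le t)) := lintegral_mono' htrim le_rfl
    _ = ∫⁻ ω, E.indicator G ω ∂μ := lintegral_trim _ hG'
    _ = ∫⁻ ω in E, G ω ∂μ := lintegral_indicator hEm _

/-- A product of increments of conditional mean at most one is unlikely to ever become large. -/
theorem measure_exists_prod_ge_le [IsProbabilityMeasure μ] (hrun : IsRun M β μ F π x)
    {f : Policy S A H → Episode S A H → ENNReal} (hf : ∀ ϖ, Measurable (f ϖ))
    (hf1 : ∀ ϖ, ∫⁻ y, f ϖ y ∂(M.episodeLaw ϖ) ≤ 1) (c : ENNReal) :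
    c * μ {ω | ∃ t, c ≤ ∏ j ∈ Finset.range t, f (π j ω) (x j ω)} ≤ 1 := by
  have hW : ∀ t, Measurable[F t] fun ω => ∏ j ∈ Finset.range t, f (π j ω) (x j ω) := by
    intro t
    refine Finset.measurable_fun_prod _ fun j hj => ?_
    exact (hrun.measurable_increment j hf).mono
      (F.mono (Nat.succ_le_of_lt (Finset.mem_range.1 hj))) le_rfl
  have := measure_exists_le_of_setLIntegral_le μ F
    (fun t ω => ∏ j ∈ Finset.range t, f (π j ω) (x j ω)) hW (fun t E hE => ?_) c
  · simpa using this
  · simp only [Finset.prod_range_succ]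
    exact hrun.lintegral_mul_increment_le t hf hf1 (hW t) hE

/-- Exponential form of `measure_exists_prod_ge_le`. -/
theorem measure_exists_sum_ge_le [IsProbabilityMeasure μ] (hrun : IsRun M β μ F π x)
    {g : Policy S A H → Episode S A H → ℝ} (hg : ∀ ϖ, Measurable (g ϖ))
    (hg1 : ∀ ϖ, ∫⁻ y, ENNReal.ofReal (Real.exp (g ϖ y)) ∂(M.episodeLaw ϖ) ≤ 1)
    {α : ℝ} (hα : 0 < α) :
    μ {ω | ∃ t, Real.log (1 / α) ≤ ∑ j ∈ Finset.range t, g (π j ω) (x j ω)} ≤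
      ENNReal.ofReal α := by
  have h := hrun.measure_exists_prod_ge_le
    (f := fun ϖ y => ENNReal.ofReal (Real.exp (g ϖ y)))
    (fun ϖ => (Real.measurable_exp.comp (hg ϖ)).ennreal_ofReal) hg1 (ENNReal.ofReal (1 / α))
  have hset : {ω | ∃ t, Real.log (1 / α) ≤ ∑ j ∈ Finset.range t, g (π j ω) (x j ω)} =
      {ω | ∃ t, ENNReal.ofReal (1 / α) ≤
        ∏ j ∈ Finset.range t, ENNReal.ofReal (Real.exp (g (π j ω) (x j ω)))} := by
    ext ω
    simp only [Set.mem_ofPred_eq]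
    refine exists_congr fun t => ?_
    rw [← ENNReal.ofReal_prod_of_nonneg fun j _ => (Real.exp_pos _).le, ← Real.exp_sum,
      ENNReal.ofReal_le_ofReal_iff (Real.exp_pos _).le, Real.log_le_iff_le_exp (by positivity)]
  rw [hset]
  rw [one_div, ENNReal.ofReal_inv_of_pos hα] at h
  rw [one_div, ENNReal.ofReal_inv_of_pos hα]
  have h0 : ENNReal.ofReal α ≠ 0 := by simpa using hα
  calc _ = ENNReal.ofReal α * ((ENNReal.ofReal α)⁻¹ * _) := by
        rw [← mul_assoc, ENNReal.mul_inv_cancel h0 ENNReal.ofReal_ne_top, one_mul]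
    _ ≤ ENNReal.ofReal α * 1 := by gcongr
    _ = _ := mul_one _

end IsRun

end BPIUCRL

/-! ### Exponential moments of rewards, transitions and visits. -/

/-- Hoeffding's lemma, as a bound by one of an exponential moment. -/
theorem lintegral_exp_hoeffding_le_one {Ω : Type*} [MeasurableSpace Ω] (ν : Measure Ω)
    [IsProbabilityMeasure ν] {X : Ω → ℝ} (hX : AEMeasurable X ν)
    (hb : ∀ᵐ ω ∂ν, X ω ∈ Set.Icc (0 : ℝ) 1) (l : ℝ) :
    ∫⁻ ω, ENNReal.ofReal (Real.exp (l * (X ω - ∫ ω, X ω ∂ν) - l ^ 2 / 8)) ∂ν ≤ 1 := by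
  -- The variance proxy on an interval of length one is `1/4`, whence `l² / 8` in the exponent.
  have h := ProbabilityTheory.hasSubgaussianMGF_of_mem_Icc hX hb
  have h1 := h.mgf_le l
  have h2 := h.integrable_exp_mul l
  have heq : ∀ ω, Real.exp (l * (X ω - ∫ ω, X ω ∂ν) - l ^ 2 / 8) =
      Real.exp (l * (X ω - ∫ ω, X ω ∂ν)) * Real.exp (-(l ^ 2 / 8)) := by
    intro ω; rw [← Real.exp_add]; ring_nf
  simp_rw [heq]
  rw [← ofReal_integral_eq_lintegral_ofReal (h2.mul_const _)
    (Filter.Eventually.of_forall fun ω => by positivity), integral_mul_const]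
  rw [← ENNReal.ofReal_one]
  apply ENNReal.ofReal_le_ofReal
  rw [Real.exp_neg, ← div_eq_mul_inv, div_le_one (Real.exp_pos _)]
  refine h1.trans (le_of_eq ?_)
  congr 1
  simp
  ring

theorem sum_exp_hoeffding_le_one {S : Type*} [Fintype S] (p : S → ℝ) (hp : ∀ s, 0 ≤ p s)
    (hp1 : ∑ s, p s = 1) (X : S → ℝ) (hX : ∀ s, X s ∈ Set.Icc (0 : ℝ) 1) (l : ℝ) :
    ∑ s, p s * Real.exp (l * (X s - ∑ s, p s * X s) - l ^ 2 / 8) ≤ 1 := by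
  let _ : MeasurableSpace S := ⊤
  set ν : Measure S := ∑ s, ENNReal.ofReal (p s) • Measure.dirac s with hν
  have : IsProbabilityMeasure ν := by
    constructor
    simp [hν, ← ENNReal.ofReal_sum_of_nonneg fun s _ => hp s, hp1]
  have hint : ∫ s, X s ∂ν = ∑ s, p s * X s := by
    rw [hν, integral_finsetSum_measure]
    · simp [integral_smul_measure, integral_dirac, hp]
    · intro s _
      exact (integrable_dirac (by simp)).smul_measure (by simp)
  have h := lintegral_exp_hoeffding_le_one ν (X := X) Measurable.of_discrete.aemeasurable
    (Filter.Eventually.of_forall hX) l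
  rw [hint, hν, lintegral_finsetSum_measure] at h
  simp only [lintegral_smul_measure, lintegral_dirac, smul_eq_mul] at h
  simp_rw [← ENNReal.ofReal_mul (hp _)] at h
  rw [← ENNReal.ofReal_sum_of_nonneg fun s _ => mul_nonneg (hp s) (Real.exp_pos _).le] at h
  simpa using h

namespace EpisodicMDP

theorem measurableSet_visit {S A : Type*} {H : ℕ} [MeasurableSpace S] [MeasurableSpace A]
    [MeasurableSingletonClass S] [MeasurableSingletonClass A]
    (h : Fin H) (s : S) (a : A) :
    MeasurableSet {x : Episode S A H | x.1 h.castSucc = s ∧ x.2.1 h = a} :=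
  (measurableSet_state h.castSucc s).inter
    (((measurable_pi_apply (X := fun _ : Fin H => A) h).comp
      (measurable_fst.comp measurable_snd)) (measurableSet_singleton a))

variable {S A : Type*} [Fintype S] {H : ℕ} (M : EpisodicMDP S A H) [DecidableEq S] [DecidableEq A]
  [MeasurableSpace S] [MeasurableSpace A]

theorem visitProb_nonneg (π : Policy S A H) (h : Fin H) (s : S) (a : A) :
    0 ≤ M.visitProb π h s a := by
  unfold visitProb
  split_ifs
  exacts [M.stateProb_nonneg π h s, le_rfl]

theorem visitProb_le_one (π : Policy S A H) (h : Fin H) (s : S) (a : A) :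
    M.visitProb π h s a ≤ 1 := by
  unfold visitProb
  split_ifs
  exacts [M.stateProb_le_one π h s, zero_le_one]

variable [MeasurableSingletonClass S] [MeasurableSingletonClass A]

theorem lintegral_exp_reward_le_one (π : Policy S A H) (h : Fin H) (s : S) (a : A) (l : ℝ) :
    ∫⁻ x, ENNReal.ofReal (Real.exp (if x.1 h.castSucc = s ∧ x.2.1 h = a then
      l * (x.2.2 h - M.r h s a) - l ^ 2 / 8 else 0)) ∂(M.episodeLaw π) ≤ 1 := by
  rw [M.lintegral_episodeLaw_reward π h (g := fun σ y =>
    ENNReal.ofReal (Real.exp (if σ h.castSucc = s ∧ π h (σ h.castSucc) = a then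
      l * (y - M.r h s a) - l ^ 2 / 8 else 0)))]
  · rw [← M.sum_ofReal_pathProb π]
    refine Finset.sum_le_sum fun σ _ => mul_le_of_le_one_right' ?_
    by_cases hσ : σ h.castSucc = s ∧ π h (σ h.castSucc) = a
    · simp only [if_pos hσ]
      obtain ⟨h1, h2⟩ := hσ
      rw [h2, h1]
      refine lintegral_exp_hoeffding_le_one (M.ν h s a) (X := fun y => y)
        measurable_id.aemeasurable ?_ l
      exact M.ν_supp h s a
    · simp [hσ]
  · refine ((Real.measurable_exp.comp (Measurable.ite (measurableSet_visit h s a) ?_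
      measurable_const))).ennreal_ofReal
    fun_prop
  · intro σ
    by_cases hσ : σ h.castSucc = s ∧ π h (σ h.castSucc) = a
    · simp only [if_pos hσ]
      fun_prop
    · simp only [if_neg hσ]
      fun_prop
  · intro σ ρ
    rfl

/-- Given the state at stage `h`, the indicator of `B` at the next state has mean `p(B | s, a)` on a
visit, so Hoeffding's lemma applies after averaging out the next state; without a visit the exponent
is `0`. -/
theorem lintegral_exp_transition_le_one (π : Policy S A H) (h : Fin H) (s : S) (a : A)
    (B : Finset S) (l : ℝ) :
    ∫⁻ x, ENNReal.ofReal (Real.exp (if x.1 h.castSucc = s ∧ x.2.1 h = a then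
      l * ((if x.1 h.succ ∈ B then 1 else 0) - ∑ s' ∈ B, M.p h s a s') - l ^ 2 / 8 else 0))
      ∂(M.episodeLaw π) ≤ 1 := by
  set φ : S → S → ℝ := fun u v => Real.exp (if u = s ∧ π h u = a then
      l * ((if v ∈ B then 1 else 0) - ∑ s' ∈ B, M.p h s a s') - l ^ 2 / 8 else 0) with hφ
  rw [M.lintegral_episodeLaw_states π (g := fun σ => φ (σ h.castSucc) (σ h.succ))
    (fun σ => (Real.exp_pos _).le)]
  · rw [M.sum_pathProb_markov, ← ENNReal.ofReal_one, ← M.sum_pathProb π]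
    refine ENNReal.ofReal_le_ofReal (Finset.sum_le_sum fun σ _ =>
      mul_le_of_le_one_right (M.pathProb_nonneg π σ) ?_)
    by_cases hσ : σ h.castSucc = s ∧ π h (σ h.castSucc) = a
    · simp only [hφ, if_pos hσ]
      obtain ⟨h1, h2⟩ := hσ
      rw [h2, h1]
      have := sum_exp_hoeffding_le_one (M.p h s a) (M.p_nonneg h s a) (M.p_sum h s a)
        (fun v => if v ∈ B then 1 else 0) (fun v => by
          by_cases hv : v ∈ B <;> simp [hv]) l
      simpa using this
    · simp [hφ, hσ, M.p_sum]
  · refine ((Real.measurable_exp.comp (Measurable.ite (measurableSet_visit h s a) ?_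
      measurable_const))).ennreal_ofReal
    have : Measurable fun x : Episode S A H => if x.1 h.succ ∈ B then (1 : ℝ) else 0 :=
      (Measurable.of_discrete (f := fun v : S => if v ∈ B then (1 : ℝ) else 0)).comp
        ((measurable_pi_apply (X := fun _ : Fin (H + 1) => S) h.succ).comp measurable_fst)
    fun_prop
  · intro σ ρ
    rfl

/-- For a Bernoulli variable of mean `q`, `e⁻¹ ≤ 1/2` bounds the moment by `e^(q/2) (1 - q/2) ≤ 1`.
This is the source of the factor `1/2` between visitation probabilities and counts. -/
theorem lintegral_exp_visit_le_one (π : Policy S A H) (h : Fin H) (s : S) (a : A) :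
    ∫⁻ x, ENNReal.ofReal (Real.exp (M.visitProb π h s a / 2 -
      if x.1 h.castSucc = s ∧ x.2.1 h = a then 1 else 0)) ∂(M.episodeLaw π) ≤ 1 := by
  set q := M.visitProb π h s a with hq
  have hq0 : 0 ≤ q := M.visitProb_nonneg π h s a
  rw [M.lintegral_episodeLaw_states π (g := fun σ => Real.exp (q / 2 -
    if σ h.castSucc = s ∧ π h (σ h.castSucc) = a then 1 else 0)) (fun σ => (Real.exp_pos _).le)]
  · have hsum : ∑ σ, M.pathProb π σ * (if σ h.castSucc = s ∧ π h (σ h.castSucc) = a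
        then (1 : ℝ) else 0) = q := by
      rw [hq]
      unfold visitProb
      split_ifs with hπ
      · rw [M.stateProb_eq_sum]
        refine Finset.sum_congr rfl fun σ _ => ?_
        congr 2
        simp only [eq_iff_iff, and_iff_left_iff_imp]
        intro h1
        rw [h1, hπ]
      · refine Finset.sum_eq_zero fun σ _ => ?_
        rw [if_neg, mul_zero]
        rintro ⟨h1, h2⟩
        rw [h1] at h2
        exact hπ h2
    have he : Real.exp (-1) ≤ 1 / 2 := by
      rw [Real.exp_neg]
      have := Real.add_one_le_exp 1
      rw [inv_eq_one_div]
      apply one_div_le_one_div_of_le <;> linarith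
    have hpt : ∀ σ : Fin (H + 1) → S, Real.exp (q / 2 -
        if σ h.castSucc = s ∧ π h (σ h.castSucc) = a then 1 else 0) ≤
        Real.exp (q / 2) * (1 - 1 / 2 * if σ h.castSucc = s ∧ π h (σ h.castSucc) = a
          then (1 : ℝ) else 0) := by
      intro σ
      rw [sub_eq_add_neg, Real.exp_add]
      refine mul_le_mul_of_nonneg_left ?_ (Real.exp_pos _).le
      split_ifs
      · linarith
      · simp
    rw [← ENNReal.ofReal_one]
    apply ENNReal.ofReal_le_ofReal
    calc _ ≤ ∑ σ, M.pathProb π σ * (Real.exp (q / 2) *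
          (1 - 1 / 2 * if σ h.castSucc = s ∧ π h (σ h.castSucc) = a then (1 : ℝ) else 0)) :=
          Finset.sum_le_sum fun σ _ =>
            mul_le_mul_of_nonneg_left (hpt σ) (M.pathProb_nonneg π σ)
      _ = Real.exp (q / 2) * (∑ σ, M.pathProb π σ - 1 / 2 * ∑ σ, M.pathProb π σ *
          (if σ h.castSucc = s ∧ π h (σ h.castSucc) = a then (1 : ℝ) else 0)) := by
          rw [Finset.mul_sum, ← Finset.sum_sub_distrib, Finset.mul_sum]
          exact Finset.sum_congr rfl fun σ _ => by ring
      _ = Real.exp (q / 2) * (1 - q / 2) := by rw [hsum, M.sum_pathProb]; ring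
      _ ≤ Real.exp (q / 2) * Real.exp (-(q / 2)) := by
          refine mul_le_mul_of_nonneg_left ?_ (Real.exp_pos _).le
          exact Real.one_sub_le_exp_neg _
      _ = 1 := by rw [← Real.exp_add]; simp
  · refine (Real.measurable_exp.comp (measurable_const.sub
      (Measurable.ite (measurableSet_visit h s a) measurable_const measurable_const))).ennreal_ofReal
  · intro σ ρ
    rfl

end EpisodicMDP

/-! ### Time-uniform deviation bounds by dyadic peeling. -/

/-- Deviation bound from exponential bounds at the scales `λ_k = √(8 ℓ_k / 2^k)`. -/
theorem sq_le_of_dyadic_exp_bounds {S c : ℝ} {n : ℕ} (hc : 0 < c) (hS : n = 0 → S = 0)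
    (hk : ∀ k : ℕ, ∀ i : Bool,
      (if i then 1 else -1) * Real.sqrt (8 * (c + k * Real.log (4 / 3)) / 2 ^ k) * S -
        (8 * (c + k * Real.log (4 / 3)) / 2 ^ k) / 8 * n < c + k * Real.log (4 / 3)) :
    S ^ 2 ≤ n * (9 / 16 * (c + 1 / 2 * Real.log n)) := by
  rcases Nat.eq_zero_or_pos n with rfl | hn
  · simp [hS rfl]
  set k := Nat.log 2 n with hkdef
  have hq1 : (2 : ℝ) ^ k ≤ n := by exact_mod_cast Nat.pow_log_le_self 2 hn.ne'
  have hq2 : (n : ℝ) ≤ 2 * 2 ^ k := by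
    have : n < 2 ^ (k + 1) := Nat.lt_pow_succ_log_self (by norm_num) n
    have h2 : (n : ℝ) < 2 ^ (k + 1) := by exact_mod_cast this
    rw [pow_succ] at h2
    linarith
  have hn' : (0 : ℝ) < n := by exact_mod_cast hn
  have hlog43 : 0 < Real.log (4 / 3) := Real.log_pos (by norm_num)
  -- The price of scale `k` is half a logarithm of `n` because `(4/3)² ≤ 2`.
  have hlogk : k * Real.log (4 / 3) ≤ 1 / 2 * Real.log n := by
    have h1 : (k : ℝ) * Real.log 2 ≤ Real.log n := by
      rw [← Real.log_pow]
      exact Real.log_le_log (by positivity) hq1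
    have h2 : 2 * Real.log (4 / 3) ≤ Real.log 2 := by
      have : (2 : ℝ) * Real.log (4 / 3) = Real.log ((4 / 3) ^ 2) := by
        rw [Real.log_pow]; norm_num
      rw [this]
      exact Real.log_le_log (by norm_num) (by norm_num)
    have : (0 : ℝ) ≤ k := by positivity
    nlinarith
  set q : ℝ := 2 ^ k with hq
  have hq0 : 0 < q := by positivity
  set l := c + k * Real.log (4 / 3) with hl
  have hl0 : 0 < l := by positivity
  -- This exponent would be optimal for `n = q`; since `q ≤ n ≤ 2 q` it loses only a constant
  -- factor.
  set lam := Real.sqrt (8 * l / q) with hlam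
  have hlam2 : lam ^ 2 = 8 * l / q := Real.sq_sqrt (by positivity)
  have h1 := hk k true
  have h2 := hk k false
  simp only [if_true, Bool.false_eq_true, if_false, ← hl, ← hq, ← hlam] at h1 h2
  have habs : |lam * S| ≤ l * (1 + n / q) := by
    have : 8 * l / q / 8 * n = l * (n / q) := by ring
    rw [abs_le]
    constructor <;> nlinarith
  have hsq : (lam * S) ^ 2 ≤ (l * (1 + n / q)) ^ 2 := by
    rw [← sq_abs]
    gcongr
  rw [mul_pow, hlam2] at hsq
  have h3 : S ^ 2 ≤ l * (q + n) ^ 2 / (8 * q) := by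
    have e1 : S ^ 2 = (8 * l / q * S ^ 2) * (q / (8 * l)) := by field_simp
    have e2 : l * (q + n) ^ 2 / (8 * q) = (l * (1 + n / q)) ^ 2 * (q / (8 * l)) := by
      field_simp
    rw [e1, e2]
    gcongr
  -- Equivalent to `(2 q - n) (n - q / 2) ≥ 0`, with equality at `n = 2 q`.
  have h4 : (q + n) ^ 2 / (8 * q) ≤ 9 / 16 * n := by
    rw [div_le_iff₀ (by positivity)]
    nlinarith [mul_nonneg (sub_nonneg.2 hq2) (sub_nonneg.2 (show q / 2 ≤ (n : ℝ) by linarith))]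
  calc S ^ 2 ≤ l * ((q + n) ^ 2 / (8 * q)) := by rw [← mul_div_assoc]; exact h3
    _ ≤ l * (9 / 16 * n) := by gcongr
    _ = n * (9 / 16 * l) := by ring
    _ ≤ _ := by gcongr; linarith

namespace BPIUCRL

namespace IsRun

variable {S A : Type*} [Fintype S] [DecidableEq S] [DecidableEq A] [MeasurableSpace S]
  [MeasurableSpace A]
  {H : ℕ} {M : EpisodicMDP S A H} {β : ℕ → ℝ} {Ω : Type*} [mΩ : MeasurableSpace Ω]
  {μ : Measure Ω} {F : Filtration ℕ mΩ} {π : ℕ → Ω → Policy S A H}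
  {x : ℕ → Ω → Episode S A H}

/-- The support condition on the rewards holds only almost surely, whereas the pathwise analysis
needs it for all episodes at once. -/
theorem ae_reward_mem_Icc (hrun : IsRun M β μ F π x) :
    ∀ᵐ ω ∂μ, ∀ j h, (x j ω).2.2 h ∈ Set.Icc (0 : ℝ) 1 := by
  rw [ae_all_iff]
  intro j
  rw [ae_all_iff]
  intro h
  set B : Set (Episode S A H) := {z | z.2.2 h ∈ (Set.Icc (0 : ℝ) 1)ᶜ} with hB
  have hBm : MeasurableSet B :=
    (show Measurable fun z : Episode S A H => z.2.2 h by fun_prop) measurableSet_Icc.compl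
  have h0 : ∀ ϖ, M.episodeLaw ϖ B = 0 := by
    intro ϖ
    rw [← lintegral_indicator_one hBm, M.lintegral_episodeLaw_reward ϖ h
      (measurable_one.indicator hBm)
      (fun _ => (Set.Icc (0 : ℝ) 1)ᶜ.indicator 1)
      (fun _ => measurable_one.indicator measurableSet_Icc.compl)]
    · refine Finset.sum_eq_zero fun σ _ => ?_
      rw [lintegral_indicator_one measurableSet_Icc.compl, M.ν_supp, mul_zero]
    · intro σ ρ
      rfl
  have h1 := hrun.law_episode j Set.univ MeasurableSet.univ B hBm
  simp only [h0, lintegral_zero, Set.univ_inter] at h1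
  exact h1

variable [MeasurableSingletonClass S] [Finite A] [MeasurableSingletonClass A]
  [IsProbabilityMeasure μ]

/-- Time-uniform deviation bound for sums over the visits to a triplet. -/
theorem measure_deviation_le (hrun : IsRun M β μ F π x) (h : Fin H) (s : S) (a : A)
    (y : Episode S A H → ℝ) (hy : Measurable y)
    (hexp : ∀ ϖ l, ∫⁻ z, ENNReal.ofReal (Real.exp (if z.1 h.castSucc = s ∧ z.2.1 h = a then
      l * y z - l ^ 2 / 8 else 0)) ∂(M.episodeLaw ϖ) ≤ 1)
    {α : ℝ} (hα : 0 < α) (hα1 : α ≤ 1) :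
    μ {ω | ∃ t, ¬ ((∑ j ∈ Finset.range t, if (x j ω).1 h.castSucc = s ∧ (x j ω).2.1 h = a
      then y (x j ω) else 0) ^ 2 ≤ (count (fun j => x j ω) t h s a : ℝ) *
        (9 / 16 * (Real.log (1 / α) + Real.log 8 +
          1 / 2 * Real.log (count (fun j => x j ω) t h s a))))} ≤ ENNReal.ofReal α := by
  set c := Real.log (1 / α) + Real.log 8 with hc
  have hc0 : 0 < c := by
    have h1 : 0 ≤ Real.log (1 / α) := Real.log_nonneg (by rw [le_div_iff₀ hα]; linarith)
    have h2 : 0 < Real.log 8 := Real.log_pos (by norm_num)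
    positivity
  set lam : ℕ × Bool → ℝ := fun ki => (if ki.2 then 1 else -1) *
    Real.sqrt (8 * (c + ki.1 * Real.log (4 / 3)) / 2 ^ ki.1) with hlam
  have hlog43 : 0 < Real.log (4 / 3) := Real.log_pos (by norm_num)
  have hlam2 : ∀ ki, lam ki ^ 2 = 8 * (c + ki.1 * Real.log (4 / 3)) / 2 ^ ki.1 := by
    intro ki
    rw [hlam, mul_pow, Real.sq_sqrt (by positivity)]
    split_ifs <;> norm_num
  -- Confidence budget per scale and sign: the geometric series sums to `4` and there are two signs,
  -- so the total is `α`.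
  set w : ℕ × Bool → ℝ := fun ki => α / 8 * (3 / 4) ^ ki.1 with hw
  have hwlog : ∀ ki, Real.log (1 / w ki) = c + ki.1 * Real.log (4 / 3) := by
    intro ki
    have : 1 / w ki = 1 / α * 8 * (4 / 3) ^ ki.1 := by
      rw [hw]
      have : ((4 : ℝ) / 3) ^ ki.1 = ((3 / 4) ^ ki.1)⁻¹ := by rw [← inv_pow]; norm_num
      simp only [this]
      field_simp
    rw [this, Real.log_mul (by positivity) (by positivity), Real.log_mul (by positivity)
      (by positivity), Real.log_pow, hc]
  set g : ℕ × Bool → Policy S A H → Episode S A H → ℝ := fun ki _ z =>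
    if z.1 h.castSucc = s ∧ z.2.1 h = a then lam ki * y z - lam ki ^ 2 / 8 else 0 with hg
  set bad : ℕ × Bool → Set Ω := fun ki => {ω | ∃ t, Real.log (1 / w ki) ≤
    ∑ j ∈ Finset.range t, g ki (π j ω) (x j ω)} with hbad
  have hbadle : ∀ ki, μ (bad ki) ≤ ENNReal.ofReal (w ki) := by
    intro ki
    refine hrun.measure_exists_sum_ge_le (g := g ki) (fun ϖ => ?_) (fun ϖ => hexp ϖ (lam ki))
      (by positivity)
    exact Measurable.ite (EpisodicMDP.measurableSet_visit h s a) (by fun_prop) measurable_const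
  have hsumw : ∑' ki, ENNReal.ofReal (w ki) = ENNReal.ofReal α := by
    have hs : HasSum (fun k : ℕ => ((3 : ℝ) / 4) ^ k) (1 - 3 / 4)⁻¹ :=
      hasSum_geometric_of_lt_one (by norm_num) (by norm_num)
    have hsum : HasSum (fun k : ℕ => α / 8 * (3 / 4 : ℝ) ^ k) (α / 2) := by
      have he : α / 2 = α / 8 * (1 - 3 / 4)⁻¹ := by norm_num; ring
      rw [he]
      exact hs.mul_left (α / 8)
    rw [ENNReal.tsum_prod', ENNReal.tsum_comm]
    have : ∀ i : Bool, ∑' k : ℕ, ENNReal.ofReal (w (k, i)) = ENNReal.ofReal (α / 2) := by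
      intro i
      rw [← hsum.tsum_eq, ENNReal.ofReal_tsum_of_nonneg (fun k => by positivity) hsum.summable]
    simp_rw [this]
    rw [tsum_fintype]
    simp only [Fintype.sum_bool]
    rw [← ENNReal.ofReal_add (by positivity) (by positivity)]
    congr 1
    ring
  refine le_trans (measure_mono ?_) ((measure_iUnion_le bad).trans
    ((ENNReal.tsum_le_tsum hbadle).trans hsumw.le))
  rintro ω ⟨t, ht⟩
  by_contra hω
  simp only [hbad, Set.mem_iUnion, Set.mem_ofPred_eq, not_exists, not_le] at hω
  refine ht (sq_le_of_dyadic_exp_bounds hc0 ?_ ?_)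
  · intro h0
    refine Finset.sum_eq_zero fun j hj => ?_
    unfold count at h0
    have := (Finset.sum_eq_zero_iff.1 h0) j hj
    split_ifs at this ⊢
    rfl
  · intro k i
    have h1 := hω (k, i) t
    rw [hwlog] at h1
    refine lt_of_eq_of_lt ?_ h1
    have h2 : ∀ j, g (k, i) (π j ω) (x j ω) =
        lam (k, i) * (if (x j ω).1 h.castSucc = s ∧ (x j ω).2.1 h = a then y (x j ω) else 0) -
        lam (k, i) ^ 2 / 8 * (if (x j ω).1 h.castSucc = s ∧ (x j ω).2.1 h = a then 1 else 0) := by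
      intro j
      simp only [hg]
      split_ifs <;> simp
    simp_rw [h2]
    rw [Finset.sum_sub_distrib, ← Finset.mul_sum, ← Finset.mul_sum, hlam2]
    simp [count, hlam]

theorem measure_reward_deviation_le (hrun : IsRun M β μ F π x) (h : Fin H) (s : S) (a : A)
    {α : ℝ} (hα : 0 < α) (hα1 : α ≤ 1) :
    μ {ω | ∃ t, ¬ ((∑ j ∈ Finset.range t, if (x j ω).1 h.castSucc = s ∧ (x j ω).2.1 h = a
      then (x j ω).2.2 h - M.r h s a else 0) ^ 2 ≤ (count (fun j => x j ω) t h s a : ℝ) *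
        (9 / 16 * (Real.log (1 / α) + Real.log 8 +
          1 / 2 * Real.log (count (fun j => x j ω) t h s a))))} ≤ ENNReal.ofReal α :=
  hrun.measure_deviation_le h s a (fun z => z.2.2 h - M.r h s a) (by fun_prop)
    (fun ϖ l => M.lintegral_exp_reward_le_one ϖ h s a l) hα hα1

theorem measure_transition_deviation_le (hrun : IsRun M β μ F π x) (h : Fin H) (s : S) (a : A)
    (B : Finset S) {α : ℝ} (hα : 0 < α) (hα1 : α ≤ 1) :
    μ {ω | ∃ t, ¬ ((∑ j ∈ Finset.range t, if (x j ω).1 h.castSucc = s ∧ (x j ω).2.1 h = a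
      then (if (x j ω).1 h.succ ∈ B then 1 else 0) - ∑ s' ∈ B, M.p h s a s' else 0) ^ 2 ≤
        (count (fun j => x j ω) t h s a : ℝ) * (9 / 16 * (Real.log (1 / α) + Real.log 8 +
          1 / 2 * Real.log (count (fun j => x j ω) t h s a))))} ≤ ENNReal.ofReal α := by
  refine hrun.measure_deviation_le h s a
    (fun z => (if z.1 h.succ ∈ B then 1 else 0) - ∑ s' ∈ B, M.p h s a s') ?_
    (fun ϖ l => M.lintegral_exp_transition_le_one ϖ h s a B l) hα hα1
  have : Measurable fun x : Episode S A H => if x.1 h.succ ∈ B then (1 : ℝ) else 0 :=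
    (Measurable.of_discrete (f := fun v : S => if v ∈ B then (1 : ℝ) else 0)).comp
      ((measurable_pi_apply (X := fun _ : Fin (H + 1) => S) h.succ).comp measurable_fst)
  fun_prop

theorem measure_count_deviation_le (hrun : IsRun M β μ F π x) (h : Fin H) (s : S) (a : A)
    {α : ℝ} (hα : 0 < α) :
    μ {ω | ∃ t, ¬ ((∑ j ∈ Finset.range t, M.visitProb (π j ω) h s a) / 2 ≤
      count (fun j => x j ω) t h s a + Real.log (1 / α))} ≤ ENNReal.ofReal α := by
  refine le_trans (measure_mono ?_) (hrun.measure_exists_sum_ge_le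
    (g := fun ϖ z => M.visitProb ϖ h s a / 2 -
      if z.1 h.castSucc = s ∧ z.2.1 h = a then 1 else 0) (fun ϖ => measurable_const.sub
      (Measurable.ite (EpisodicMDP.measurableSet_visit h s a) measurable_const measurable_const))
    (fun ϖ => M.lintegral_exp_visit_le_one ϖ h s a) hα)
  rintro ω ⟨t, ht⟩
  refine ⟨t, ?_⟩
  rw [Finset.sum_sub_distrib, ← Finset.sum_div]
  simp only [count, Nat.cast_sum, Nat.cast_ite, Nat.cast_one, Nat.cast_zero, not_le] at ht
  linarith

end IsRun

end BPIUCRL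

/-! ### Ranges and comparison of the value functions. -/

namespace EpisodicMDP

section Values

variable {S A : Type*} [Fintype S] {H : ℕ} (M : EpisodicMDP S A H)

theorem r_mem_Icc (h : Fin H) (s : S) (a : A) : M.r h s a ∈ Set.Icc (0 : ℝ) 1 := by
  have hae : ∀ᵐ y ∂(M.ν h s a), y ∈ Set.Icc (0 : ℝ) 1 := M.ν_supp h s a
  have hint : Integrable (fun y : ℝ => y) (M.ν h s a) :=
    Integrable.of_mem_Icc 0 1 measurable_id.aemeasurable hae
  constructor
  · exact integral_nonneg_of_ae (hae.mono fun y hy => hy.1)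
  · have := integral_mono_ae hint (integrable_const 1) (hae.mono fun y hy => hy.2)
    simpa [r] using this

theorem V_last (π : Policy S A H) (s : S) : M.V π (Fin.last H) s = 0 := by
  simp [V, backward_last]

theorem V_castSucc (π : Policy S A H) (h : Fin H) (s : S) :
    M.V π h.castSucc s = M.r h s (π h s) + ∑ s', M.p h s (π h s) s' * M.V π h.succ s' := by
  simp [V, backward_castSucc]

theorem Vstar_last (s : S) : M.Vstar (Fin.last H) s = 0 := by
  simp [Vstar, backward_last]

theorem Vstar_castSucc (h : Fin H) (s : S) :
    M.Vstar h.castSucc s = ⨆ a, (M.r h s a + ∑ s', M.p h s a s' * M.Vstar h.succ s') := by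
  simp [Vstar, backward_castSucc]

theorem sum_p_mul_mem (h : Fin H) (s : S) (a : A) {W : S → ℝ} {K : ℝ}
    (hW : ∀ s, 0 ≤ W s ∧ W s ≤ K) :
    0 ≤ ∑ s', M.p h s a s' * W s' ∧ ∑ s', M.p h s a s' * W s' ≤ K := by
  constructor
  · exact Finset.sum_nonneg fun s' _ => mul_nonneg (M.p_nonneg _ _ _ _) (hW s').1
  · calc _ ≤ ∑ s', M.p h s a s' * K := Finset.sum_le_sum fun s' _ =>
          mul_le_mul_of_nonneg_left (hW s').2 (M.p_nonneg _ _ _ _)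
      _ = K := by rw [← Finset.sum_mul, M.p_sum, one_mul]

theorem V_mem (π : Policy S A H) (i : Fin (H + 1)) (s : S) :
    0 ≤ M.V π i s ∧ M.V π i s ≤ (H : ℝ) - (i : ℕ) := by
  induction i using Fin.reverseInduction generalizing s with
  | last => simp [V_last]
  | cast h ih =>
    rw [V_castSucc]
    have h1 := M.sum_p_mul_mem h s (π h s) ih
    have h2 := M.r_mem_Icc h s (π h s)
    simp only [Fin.val_succ, Nat.cast_add, Nat.cast_one, Fin.val_castSucc] at *
    exact ⟨by linarith [h2.1], by linarith [h2.2]⟩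

theorem Vstar_mem [Nonempty A] (i : Fin (H + 1)) (s : S) :
    0 ≤ M.Vstar i s ∧ M.Vstar i s ≤ (H : ℝ) - (i : ℕ) := by
  induction i using Fin.reverseInduction generalizing s with
  | last => simp [Vstar_last]
  | cast h ih =>
    rw [Vstar_castSucc]
    have h1 := fun a => M.sum_p_mul_mem h s a ih
    have h2 := M.r_mem_Icc h s
    simp only [Fin.val_succ, Nat.cast_add, Nat.cast_one, Fin.val_castSucc] at *
    constructor
    · exact Real.iSup_nonneg fun a => by linarith [(h1 a).1, (h2 a).1]
    · exact ciSup_le fun a => by linarith [(h1 a).2, (h2 a).2]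

theorem V_le_Vstar [Finite A] (π : Policy S A H) (i : Fin (H + 1)) (s : S) : M.V π i s ≤ M.Vstar i s := by
  induction i using Fin.reverseInduction generalizing s with
  | last => simp [Vstar_last, V_last]
  | cast h ih =>
    rw [Vstar_castSucc, V_castSucc]
    refine le_trans ?_ (le_ciSup (Set.finite_range _).bddAbove (π h s))
    gcongr with s'
    · exact M.p_nonneg _ _ _ _
    · exact ih s'

end Values

end EpisodicMDP

/-! ### Accurate estimates: optimism and gap recursions. -/

namespace BPIUCRL

noncomputable section

/-- For `0 ≤ W ≤ K` the worst case keeps the positive entries of `d` with weight `K` and drops the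
others, which is the value of `d` on a single set; apply this to `d` and `-d`. -/
theorem abs_sum_mul_le {S : Type*} [Fintype S] {d W : S → ℝ} {K e : ℝ} (hK : 0 ≤ K)
    (hd : ∀ B : Finset S, |∑ s ∈ B, d s| ≤ e) (hW : ∀ s, 0 ≤ W s ∧ W s ≤ K) :
    |∑ s, d s * W s| ≤ K * e := by
  classical
  have hpos : ∀ f : S → ℝ, ∑ s, f s * W s ≤ K * ∑ s ∈ Finset.univ.filter (fun s => 0 ≤ f s), f s := by
    intro f
    rw [Finset.sum_filter, Finset.mul_sum]
    refine Finset.sum_le_sum fun s _ => ?_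
    split_ifs with h
    · rw [mul_comm]
      exact mul_le_mul_of_nonneg_right (hW s).2 h
    · rw [mul_zero]
      exact mul_nonpos_of_nonpos_of_nonneg (not_le.1 h).le (hW s).1
  rw [abs_le]
  constructor
  · have h1 := hpos fun s => -d s
    have h2 := (abs_le.1 (hd (Finset.univ.filter fun s => 0 ≤ -d s))).1
    simp only [Finset.sum_neg_distrib, neg_mul] at h1
    nlinarith
  · have h1 := hpos d
    have h2 := (abs_le.1 (hd (Finset.univ.filter fun s => 0 ≤ d s))).2
    nlinarith

variable {S A : Type*} {H : ℕ}

theorem IsGreedy.iSup_eq [Finite A] {Q : Fin H → S → A → ℝ} {π : Policy S A H} (hπ : IsGreedy Q π)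
    (h : Fin H) (s : S) : ⨆ a, Q h s a = Q h s (π h s) :=
  have : Nonempty A := ⟨π h s⟩
  le_antisymm (ciSup_le (hπ h s)) (le_ciSup (Set.finite_range _).bddAbove (π h s))

theorem exists_isGreedy [Finite A] [Nonempty A] (Q : Fin H → S → A → ℝ) :
    ∃ π : Policy S A H, IsGreedy Q π := by
  choose π hπ using fun (h : Fin H) (s : S) => Finite.exists_max (Q h s)
  exact ⟨π, fun h s a => hπ h s a⟩

section

variable [DecidableEq S] [DecidableEq A]

/-- The relative confidence width: the bonus is `H - h` times it. -/
def width (β : ℕ → ℝ) (x : ℕ → Episode S A H) (t : ℕ) (h : Fin H) (s : S) (a : A) : ℝ :=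
  if count x t h s a = 0 then 1 else min (Real.sqrt (β (count x t h s a) / count x t h s a)) 1

theorem bonus_eq (β : ℕ → ℝ) (x : ℕ → Episode S A H) (t : ℕ) (h : Fin H) (s : S) (a : A) :
    bonus β x t h s a = ((H : ℝ) - (h : ℕ)) * width β x t h s a := rfl

theorem width_nonneg (β : ℕ → ℝ) (x : ℕ → Episode S A H) (t : ℕ) (h : Fin H) (s : S) (a : A) :
    0 ≤ width β x t h s a := by
  unfold width
  split_ifs <;> positivity

theorem width_le_one (β : ℕ → ℝ) (x : ℕ → Episode S A H) (t : ℕ) (h : Fin H) (s : S) (a : A) :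
    width β x t h s a ≤ 1 := by
  unfold width
  split_ifs
  exacts [le_rfl, min_le_right _ _]

/-- Converts a lower bound on the width into an upper bound on the count. -/
theorem count_mul_width_sq_le {β : ℕ → ℝ} (hβ : ∀ n, 0 ≤ β n) (x : ℕ → Episode S A H) (t : ℕ)
    (h : Fin H) (s : S) (a : A) :
    count x t h s a * width β x t h s a ^ 2 ≤ β (count x t h s a) := by
  unfold width
  split_ifs with h0
  · simpa [h0] using hβ 0
  · have hn : (0 : ℝ) < count x t h s a := by exact_mod_cast Nat.pos_of_ne_zero h0
    have hnn := hβ (count x t h s a)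
    have : min (Real.sqrt (β (count x t h s a) / count x t h s a)) 1 ^ 2 ≤
        β (count x t h s a) / count x t h s a := by
      rw [← Real.sq_sqrt (show 0 ≤ β (count x t h s a) / count x t h s a by positivity)]
      gcongr
      rw [Real.sq_sqrt (by positivity)]
      exact min_le_left _ _
    calc _ ≤ count x t h s a * (β (count x t h s a) / count x t h s a) := by gcongr
      _ = _ := by field_simp

/-- Bounded empirical quantities whose deviation is controlled by the width, after `t` episodes. -/
structure Accurate [Fintype S] (M : EpisodicMDP S A H) (β : ℕ → ℝ) (x : ℕ → Episode S A H)
    (t : ℕ) : Prop where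
  rHat_mem : ∀ h s a, rHat x t h s a ∈ Set.Icc (0 : ℝ) 1
  pHat_nonneg : ∀ h s a s', 0 ≤ pHat x t h s a s'
  reward : ∀ h s a, |rHat x t h s a - M.r h s a| ≤ width β x t h s a
  transition : ∀ h s a (K : ℝ) (W : S → ℝ), 0 ≤ K → (∀ s, 0 ≤ W s ∧ W s ≤ K) →
    |∑ s', (pHat x t h s a s' - M.p h s a s') * W s'| ≤ K * width β x t h s a

theorem rHat_mem_Icc {x : ℕ → Episode S A H} (hx : ∀ j h, (x j).2.2 h ∈ Set.Icc (0 : ℝ) 1)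
    (t : ℕ) (h : Fin H) (s : S) (a : A) : rHat x t h s a ∈ Set.Icc (0 : ℝ) 1 := by
  unfold rHat
  constructor
  · refine div_nonneg (Finset.sum_nonneg fun j _ => ?_) (Nat.cast_nonneg _)
    split_ifs
    exacts [(hx j h).1, le_rfl]
  · refine div_le_one_of_le₀ ?_ (Nat.cast_nonneg _)
    unfold count
    push_cast
    refine Finset.sum_le_sum fun j _ => ?_
    split_ifs
    exacts [(hx j h).2, le_rfl]

theorem pHat_nonneg (x : ℕ → Episode S A H) (t : ℕ) (h : Fin H) (s : S) (a : A) (s' : S) :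
    0 ≤ pHat x t h s a s' := by
  unfold pHat
  refine div_nonneg (Finset.sum_nonneg fun j _ => ?_) (Nat.cast_nonneg _)
  split_ifs <;> norm_num

theorem sum_pHat (x : ℕ → Episode S A H) (t : ℕ) (h : Fin H) (s : S) (a : A) (B : Finset S) :
    ∑ s' ∈ B, pHat x t h s a s' = (∑ j ∈ Finset.range t,
      if (x j).1 h.castSucc = s ∧ (x j).2.1 h = a then
        (if (x j).1 h.succ ∈ B then (1 : ℝ) else 0) else 0) / count x t h s a := by
  unfold pHat
  rw [← Finset.sum_div, Finset.sum_comm]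
  congr 1
  refine Finset.sum_congr rfl fun j _ => ?_
  by_cases hv : (x j).1 h.castSucc = s ∧ (x j).2.1 h = a
  · simp [hv.1, hv.2]
  · rw [if_neg hv]
    refine Finset.sum_eq_zero fun s' _ => ?_
    rw [if_neg]
    tauto

theorem sum_pHat_le_one (x : ℕ → Episode S A H) (t : ℕ) (h : Fin H) (s : S) (a : A)
    (B : Finset S) : ∑ s' ∈ B, pHat x t h s a s' ≤ 1 := by
  rw [sum_pHat]
  refine div_le_one_of_le₀ ?_ (Nat.cast_nonneg _)
  unfold count
  push_cast
  refine Finset.sum_le_sum fun j _ => ?_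
  split_ifs <;> norm_num

/-- Two numbers of `[0, 1]` differ by at most `1`, which settles the truncation and also the case of
no visit, where the quotient is `0` by convention and the width is `1`. -/
theorem abs_div_sub_le_width {β : ℕ → ℝ} {x : ℕ → Episode S A H} {t : ℕ} {h : Fin H} {s : S}
    {a : A} (y : ℕ → ℝ) (m : ℝ) (hy : (∑ j ∈ Finset.range t,
      if (x j).1 h.castSucc = s ∧ (x j).2.1 h = a then y j else 0) / count x t h s a ∈
      Set.Icc (0 : ℝ) 1) (hm : m ∈ Set.Icc (0 : ℝ) 1)
    (hdev : (∑ j ∈ Finset.range t, if (x j).1 h.castSucc = s ∧ (x j).2.1 h = a then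
      y j - m else 0) ^ 2 ≤ count x t h s a * β (count x t h s a)) :
    |(∑ j ∈ Finset.range t, if (x j).1 h.castSucc = s ∧ (x j).2.1 h = a then y j else 0) /
      count x t h s a - m| ≤ width β x t h s a := by
  have h1 : |(∑ j ∈ Finset.range t, if (x j).1 h.castSucc = s ∧ (x j).2.1 h = a then y j else 0) /
      count x t h s a - m| ≤ 1 := by
    rw [abs_le]
    constructor <;> linarith [hy.1, hy.2, hm.1, hm.2]
  unfold width
  split_ifs with h0
  · exact h1
  refine le_min ?_ h1
  have hn : (0 : ℝ) < count x t h s a := by exact_mod_cast Nat.pos_of_ne_zero h0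
  refine Real.abs_le_sqrt ?_
  have hsum : (∑ j ∈ Finset.range t, if (x j).1 h.castSucc = s ∧ (x j).2.1 h = a then
      y j - m else 0) = (∑ j ∈ Finset.range t, if (x j).1 h.castSucc = s ∧ (x j).2.1 h = a then
      y j else 0) - count x t h s a * m := by
    have hc : (count x t h s a : ℝ) * m = ∑ j ∈ Finset.range t,
        if (x j).1 h.castSucc = s ∧ (x j).2.1 h = a then m else 0 := by
      unfold count
      push_cast
      rw [Finset.sum_mul]
      exact Finset.sum_congr rfl fun j _ => by split_ifs <;> simp
    rw [hc, ← Finset.sum_sub_distrib]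
    exact Finset.sum_congr rfl fun j _ => by split_ifs <;> simp
  rw [hsum] at hdev
  generalize (∑ j ∈ Finset.range t, if (x j).1 h.castSucc = s ∧ (x j).2.1 h = a then
      y j else 0) = Y at hdev
  generalize (count x t h s a : ℝ) = n at hdev hn
  rw [show Y / n - m = (Y - n * m) / n by field_simp, div_pow, div_le_div_iff₀ (by positivity) hn]
  nlinarith

variable [Fintype S]

theorem Accurate.of_deviation {M : EpisodicMDP S A H} {β : ℕ → ℝ} {x : ℕ → Episode S A H} {t : ℕ}
    (hx : ∀ j h, (x j).2.2 h ∈ Set.Icc (0 : ℝ) 1)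
    (hr : ∀ h s a, (∑ j ∈ Finset.range t, if (x j).1 h.castSucc = s ∧ (x j).2.1 h = a then
      (x j).2.2 h - M.r h s a else 0) ^ 2 ≤ count x t h s a * β (count x t h s a))
    (hp : ∀ h s a (B : Finset S), (∑ j ∈ Finset.range t,
      if (x j).1 h.castSucc = s ∧ (x j).2.1 h = a then
        (if (x j).1 h.succ ∈ B then 1 else 0) - ∑ s' ∈ B, M.p h s a s' else 0) ^ 2 ≤
          count x t h s a * β (count x t h s a)) : Accurate M β x t where
  rHat_mem := rHat_mem_Icc hx t
  pHat_nonneg := BPIUCRL.pHat_nonneg x t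
  reward h s a := abs_div_sub_le_width (fun j => (x j).2.2 h) (M.r h s a)
    (rHat_mem_Icc hx t h s a) (M.r_mem_Icc h s a) (hr h s a)
  transition h s a K W hK hW := by
    refine abs_sum_mul_le hK (fun B => ?_) hW
    rw [Finset.sum_sub_distrib, sum_pHat]
    refine abs_div_sub_le_width (fun j => if (x j).1 h.succ ∈ B then 1 else 0)
      (∑ s' ∈ B, M.p h s a s') ?_ ?_ (hp h s a B)
    · rw [← sum_pHat]
      exact ⟨Finset.sum_nonneg fun s' _ => BPIUCRL.pHat_nonneg x t h s a s', sum_pHat_le_one x t h s a B⟩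
    · refine ⟨Finset.sum_nonneg fun s' _ => M.p_nonneg h s a s', ?_⟩
      rw [← M.p_sum h s a]
      exact Finset.sum_le_sum_of_subset_of_nonneg (Finset.subset_univ _)
        fun s' _ _ => M.p_nonneg h s a s'

theorem upperV_last (β : ℕ → ℝ) (x : ℕ → Episode S A H) (t : ℕ) (s : S) :
    upperV β x t (Fin.last H) s = 0 := by
  simp [upperV, backward_last]

theorem upperV_castSucc (β : ℕ → ℝ) (x : ℕ → Episode S A H) (t : ℕ) (h : Fin H) (s : S) :
    upperV β x t h.castSucc s = ⨆ a, upperQ β x t h s a := by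
  simp [upperV, backward_castSucc, upperQ]

theorem lowerV_last (β : ℕ → ℝ) (x : ℕ → Episode S A H) (t : ℕ) (s : S) :
    lowerV β x t (Fin.last H) s = 0 := by
  simp [lowerV, backward_last]

theorem lowerV_castSucc (β : ℕ → ℝ) (x : ℕ → Episode S A H) (t : ℕ) (h : Fin H) (s : S) :
    lowerV β x t h.castSucc s = ⨆ a, lowerQ β x t h s a := by
  simp [lowerV, backward_castSucc, lowerQ]

theorem sum_pHat_eq (x : ℕ → Episode S A H) (t : ℕ) (M : EpisodicMDP S A H)
    (h : Fin H) (s : S) (a : A) (W : S → ℝ) : ∑ s', pHat x t h s a s' * W s' =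
    ∑ s', M.p h s a s' * W s' + ∑ s', (pHat x t h s a s' - M.p h s a s') * W s' := by
  rw [← Finset.sum_add_distrib]
  exact Finset.sum_congr rfl fun s' _ => by ring

variable {M : EpisodicMDP S A H} {β : ℕ → ℝ} {x : ℕ → Episode S A H} {t : ℕ}

theorem lowerV_nonneg (i : Fin (H + 1)) (s : S) : 0 ≤ lowerV β x t i s := by
  induction i using Fin.reverseInduction with
  | last => rw [lowerV_last]
  | cast h ih =>
    rw [lowerV_castSucc]
    exact Real.iSup_nonneg fun a => le_max_left _ _

theorem upperV_le [Nonempty A] (i : Fin (H + 1)) (s : S) : upperV β x t i s ≤ (H : ℝ) - (i : ℕ) := by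
  induction i using Fin.reverseInduction with
  | last => simp [upperV_last]
  | cast h ih =>
    rw [upperV_castSucc]
    exact ciSup_le fun a => min_le_left _ _

variable [Finite A]

namespace Accurate

/-- The lower bound is a lower bound on the value of the policy that is greedy for it. -/
theorem lowerV_le_V (hacc : Accurate M β x t) {π : Policy S A H}
    (hπ : IsGreedy (lowerQ β x t) π) (i : Fin (H + 1)) (s : S) :
    lowerV β x t i s ≤ M.V π i s := by
  induction i using Fin.reverseInduction generalizing s with
  | last => rw [lowerV_last, M.V_last]
  | cast h ih =>
    have hnn := (M.V_mem π h.castSucc s).1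
    have hmem := M.V_mem π h.succ
    rw [lowerV_castSucc, hπ.iSup_eq]
    refine max_le hnn ?_
    rw [M.V_castSucc]
    have hK : (0 : ℝ) ≤ (H : ℝ) - (h.succ : ℕ) := by
      have : ((h.succ : ℕ) : ℝ) ≤ H := by exact_mod_cast h.succ.is_le
      linarith
    -- The reward error costs one width and the transition error `H - h - 1` widths, together
    -- exactly the bonus.
    have h1 := (abs_le.1 (hacc.reward h s (π h s))).2
    have h2 := (abs_le.1 (hacc.transition h s (π h s) _ _ hK hmem)).2
    have h3 : ∑ s', pHat x t h s (π h s) s' * lowerV β x t h.succ s' ≤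
        ∑ s', pHat x t h s (π h s) s' * M.V π h.succ s' :=
      Finset.sum_le_sum fun s' _ =>
        mul_le_mul_of_nonneg_left (ih s') (hacc.pHat_nonneg h s (π h s) s')
    rw [sum_pHat_eq x t M _ _ _ (M.V π h.succ)] at h3
    rw [bonus_eq]
    simp only [Fin.val_succ, Nat.cast_add, Nat.cast_one] at h2
    linarith

variable [Nonempty A]

/-- Optimism. -/
theorem Vstar_le_upperV (hacc : Accurate M β x t) (i : Fin (H + 1)) (s : S) :
    M.Vstar i s ≤ upperV β x t i s := by
  induction i using Fin.reverseInduction generalizing s with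
  | last => rw [upperV_last, M.Vstar_last]
  | cast h ih =>
    have hle := (M.Vstar_mem h.castSucc s).2
    have hmem := M.Vstar_mem h.succ
    rw [upperV_castSucc]
    rw [M.Vstar_castSucc] at hle ⊢
    refine ciSup_mono (Set.finite_range _).bddAbove fun a => ?_
    -- The cap at `H - h` is harmless because the optimal value obeys it.
    refine le_min ((le_ciSup (Set.finite_range _).bddAbove a).trans hle) ?_
    have hK : (0 : ℝ) ≤ (H : ℝ) - (h.succ : ℕ) := by
      have : ((h.succ : ℕ) : ℝ) ≤ H := by exact_mod_cast h.succ.is_le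
      linarith
    have h1 := (abs_le.1 (hacc.reward h s a)).1
    have h2 := (abs_le.1 (hacc.transition h s a _ _ hK hmem)).1
    have h3 : ∑ s', pHat x t h s a s' * M.Vstar h.succ s' ≤
        ∑ s', pHat x t h s a s' * upperV β x t h.succ s' :=
      Finset.sum_le_sum fun s' _ => mul_le_mul_of_nonneg_left (ih s') (hacc.pHat_nonneg h s a s')
    rw [sum_pHat_eq x t M] at h3
    rw [bonus_eq]
    simp only [Fin.val_succ, Nat.cast_add, Nat.cast_one] at h2
    linarith

theorem lowerV_le_Vstar (hacc : Accurate M β x t) (i : Fin (H + 1)) (s : S) :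
    lowerV β x t i s ≤ M.Vstar i s := by
  obtain ⟨π, hπ⟩ := exists_isGreedy (lowerQ β x t)
  exact (hacc.lowerV_le_V hπ i s).trans (M.V_le_Vstar π i s)

/-- One-step recursion for the gap between the upper and the lower bounds. -/
theorem upperV_sub_lowerV_le (hacc : Accurate M β x t) {π : Policy S A H}
    (hπ : IsGreedy (upperQ β x t) π) (h : Fin H) (s : S) :
    upperV β x t h.castSucc s - lowerV β x t h.castSucc s ≤
      3 * (((H : ℝ) - (h : ℕ)) * width β x t h s (π h s)) +
        ∑ s', M.p h s (π h s) s' * (upperV β x t h.succ s' - lowerV β x t h.succ s') := by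
  have hmem : ∀ s', 0 ≤ upperV β x t h.succ s' - lowerV β x t h.succ s' ∧
      upperV β x t h.succ s' - lowerV β x t h.succ s' ≤ (H : ℝ) - (h.succ : ℕ) := fun s' =>
    ⟨by linarith [hacc.lowerV_le_Vstar h.succ s', hacc.Vstar_le_upperV h.succ s'],
      by linarith [lowerV_nonneg (β := β) (x := x) (t := t) h.succ s',
        upperV_le (β := β) (x := x) (t := t) h.succ s']⟩
  have hK : (0 : ℝ) ≤ (H : ℝ) - (h.succ : ℕ) := by
    have : ((h.succ : ℕ) : ℝ) ≤ H := by exact_mod_cast h.succ.is_le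
    linarith
  -- Transition accuracy is applied to the data-dependent gap itself, which is allowed as it is
  -- uniform in the test function. With the two bonuses this makes the factor `3`.
  have h2 := (abs_le.1 (hacc.transition h s (π h s) _ _ hK hmem)).2
  have hu : upperV β x t h.castSucc s ≤ rHat x t h s (π h s) + bonus β x t h s (π h s) +
      ∑ s', pHat x t h s (π h s) s' * upperV β x t h.succ s' := by
    rw [upperV_castSucc, hπ.iSup_eq]
    exact min_le_right _ _
  have hl : rHat x t h s (π h s) - bonus β x t h s (π h s) +
      ∑ s', pHat x t h s (π h s) s' * lowerV β x t h.succ s' ≤ lowerV β x t h.castSucc s := by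
    rw [lowerV_castSucc]
    exact (le_max_right _ _).trans
      (le_ciSup (f := fun a => lowerQ β x t h s a) (Set.finite_range _).bddAbove (π h s))
  have hsum := sum_pHat_eq x t M h s (π h s)
    (fun s' => upperV β x t h.succ s' - lowerV β x t h.succ s')
  have hsum' : ∑ s', pHat x t h s (π h s) s' *
      (upperV β x t h.succ s' - lowerV β x t h.succ s') =
      ∑ s', pHat x t h s (π h s) s' * upperV β x t h.succ s' -
      ∑ s', pHat x t h s (π h s) s' * lowerV β x t h.succ s' := by
    simp only [mul_sub, Finset.sum_sub_distrib]
  rw [bonus_eq] at hu hl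
  have hw := width_nonneg β x t h s (π h s)
  simp only [Fin.val_succ, Nat.cast_add, Nat.cast_one] at h2
  linarith

/-- One-step recursion for the optimism of the upper bound. -/
theorem upperV_sub_V_le (hacc : Accurate M β x t) {π : Policy S A H}
    (hπ : IsGreedy (upperQ β x t) π) (h : Fin H) (s : S) :
    upperV β x t h.castSucc s - M.V π h.castSucc s ≤
      3 * (((H : ℝ) - (h : ℕ)) * width β x t h s (π h s)) +
        ∑ s', M.p h s (π h s) s' * (upperV β x t h.succ s' - M.V π h.succ s') := by
  have hmem : ∀ s', 0 ≤ upperV β x t h.succ s' ∧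
      upperV β x t h.succ s' ≤ (H : ℝ) - (h.succ : ℕ) := fun s' =>
    ⟨(M.Vstar_mem h.succ s').1.trans (hacc.Vstar_le_upperV h.succ s'), upperV_le h.succ s'⟩
  have hK : (0 : ℝ) ≤ (H : ℝ) - (h.succ : ℕ) := by
    have : ((h.succ : ℕ) : ℝ) ≤ H := by exact_mod_cast h.succ.is_le
    linarith
  have h1 := (abs_le.1 (hacc.reward h s (π h s))).2
  have h2 := (abs_le.1 (hacc.transition h s (π h s) _ _ hK hmem)).2
  have hu : upperV β x t h.castSucc s ≤ rHat x t h s (π h s) + bonus β x t h s (π h s) +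
      ∑ s', pHat x t h s (π h s) s' * upperV β x t h.succ s' := by
    rw [upperV_castSucc, hπ.iSup_eq]
    exact min_le_right _ _
  rw [sum_pHat_eq x t M, bonus_eq] at hu
  rw [M.V_castSucc]
  simp only [mul_sub, Finset.sum_sub_distrib]
  -- One bonus and one estimation error would give the factor `2`; the weaker `3` makes both
  -- recursions have the same form.
  have hw : 0 ≤ ((H : ℝ) - ((h : ℕ) + 1)) * width β x t h s (π h s) := by
    have := width_nonneg β x t h s (π h s)
    simp only [Fin.val_succ, Nat.cast_add, Nat.cast_one] at hK
    positivity
  have hw' := width_nonneg β x t h s (π h s)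
  simp only [Fin.val_succ, Nat.cast_add, Nat.cast_one] at h2
  linarith

end Accurate

end

end

end BPIUCRL

/-! ### Two-sided estimates of the threshold and self-bounding. -/

namespace BPIUCRL

section Threshold

variable {S A H : ℕ} {δ : ℝ}

theorem one_le_log_confidence (hS : 1 ≤ S) (hA : 1 ≤ A) (hH : 1 ≤ H) (hδ : 0 < δ) (hδ1 : δ < 1) :
    1 ≤ Real.log (3 * S * A * H / δ) := by
  have hS' : (1 : ℝ) ≤ S := by exact_mod_cast hS
  have hA' : (1 : ℝ) ≤ A := by exact_mod_cast hA
  have hH' : (1 : ℝ) ≤ H := by exact_mod_cast hH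
  rw [Real.le_log_iff_exp_le (by positivity), le_div_iff₀ hδ]
  have h1 : (1 : ℝ) ≤ S * A * H := one_le_mul_of_one_le_of_one_le
    (one_le_mul_of_one_le_of_one_le hS' hA') hH'
  nlinarith [Real.exp_one_lt_d9, Real.exp_pos 1]

theorem log_exp_one_mul {y : ℝ} (hy : 0 < y) :
    Real.log (Real.exp 1 * y) = 1 + Real.log y := by
  rw [Real.log_mul (Real.exp_pos 1).ne' hy.ne', Real.log_exp]

theorem betaR_eq (n : ℕ) :
    betaR S A H δ n = 1 / 2 * (Real.log (3 * S * A * H / δ) + (1 + Real.log (1 + n))) := by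
  rw [betaR, log_exp_one_mul (by positivity)]

theorem betaP_lower (hS : 1 ≤ S) (n : ℕ) :
    Real.log (3 * S * A * H / δ) + (S - 1) ≤ betaP S A H δ n := by
  have hS' : (0 : ℝ) ≤ (S : ℝ) - 1 := by
    have : (1 : ℝ) ≤ S := by exact_mod_cast hS
    linarith
  -- For `S = 1` the quotient is `0` by convention and its logarithmic term has coefficient `0`.
  have hn : (0 : ℝ) ≤ n / ((S : ℝ) - 1) := by positivity
  rw [betaP, log_exp_one_mul (by positivity)]
  have := Real.log_nonneg (show (1 : ℝ) ≤ 1 + n / ((S : ℝ) - 1) by linarith)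
  nlinarith

theorem betaP_upper (hS : 1 ≤ S) (n : ℕ) :
    betaP S A H δ n ≤ Real.log (3 * S * A * H / δ) + (S - 1) * (1 + Real.log (1 + n)) := by
  rcases Nat.lt_or_ge 1 S with h | h
  · have hS' : (1 : ℝ) ≤ (S : ℝ) - 1 := by
      have : (2 : ℝ) ≤ S := by exact_mod_cast h
      linarith
    rw [betaP, log_exp_one_mul (by positivity)]
    gcongr
    exact div_le_self (by positivity) hS'
  · obtain rfl : S = 1 := le_antisymm h hS
    simp [betaP]

/-- Expand the square and drop the cross term. -/
theorem le_beta (hS : 1 ≤ S) (hL : 1 ≤ Real.log (3 * S * A * H / δ)) (n : ℕ) :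
    5 / 2 * Real.log (3 * S * A * H / δ) + 1 / 2 * (1 + Real.log (1 + n)) + 2 * (S - 1) ≤
      beta S A H δ n := by
  have hS' : (1 : ℝ) ≤ S := by exact_mod_cast hS
  have h1 := betaP_lower (A := A) (H := H) (δ := δ) hS n
  have hlog := Real.log_nonneg (show (1 : ℝ) ≤ 1 + n by simp)
  have hR : 0 ≤ betaR S A H δ n := by rw [betaR_eq]; positivity
  have hP : 0 ≤ 2 * betaP S A H δ n := by linarith
  unfold beta
  have hc : 0 ≤ Real.sqrt (betaR S A H δ n) * Real.sqrt (2 * betaP S A H δ n) := by positivity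
  rw [add_sq, Real.sq_sqrt hR, Real.sq_sqrt hP, betaR_eq]
  rw [betaR_eq] at hc
  nlinarith

/-- From `(√a + √b)² ≤ 2 a + 2 b`. -/
theorem beta_le (hS : 1 ≤ S) (hL : 1 ≤ Real.log (3 * S * A * H / δ)) (n : ℕ) :
    beta S A H δ n ≤
      5 * Real.log (3 * S * A * H / δ) + 4 * S * (1 + Real.log (1 + n)) := by
  have hS' : (1 : ℝ) ≤ S := by exact_mod_cast hS
  have h1 := betaP_lower (A := A) (H := H) (δ := δ) hS n
  have h2 := betaP_upper (A := A) (H := H) (δ := δ) hS n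
  have hlog := Real.log_nonneg (show (1 : ℝ) ≤ 1 + n by simp)
  have hR : 0 ≤ betaR S A H δ n := by rw [betaR_eq]; positivity
  have hP : 0 ≤ 2 * betaP S A H δ n := by linarith
  have h3 : beta S A H δ n ≤ 2 * betaR S A H δ n + 2 * (2 * betaP S A H δ n) := by
    unfold beta
    nlinarith [Real.sq_sqrt hR, Real.sq_sqrt hP,
      sq_nonneg (Real.sqrt (betaR S A H δ n) - Real.sqrt (2 * betaP S A H δ n))]
  rw [betaR_eq] at h3
  nlinarith

/-- The threshold dominates the deviation level for a union over all subsets of states. -/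
theorem deviation_level_le_beta (hS : 1 ≤ S) (hL : 1 ≤ Real.log (3 * S * A * H / δ)) (n : ℕ) :
    9 / 16 * (Real.log (3 * S * A * H / δ) + S * Real.log 2 + Real.log 8 +
      1 / 2 * Real.log n) ≤ beta S A H δ n := by
  have hS' : (1 : ℝ) ≤ S := by exact_mod_cast hS
  have h1 := le_beta (A := A) (H := H) (δ := δ) hS hL n
  have h8 : Real.log 8 = 3 * Real.log 2 := by
    rw [show (8 : ℝ) = 2 ^ 3 by norm_num, Real.log_pow]; norm_num
  have h2 : Real.log n ≤ Real.log (1 + n) := by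
    rcases Nat.eq_zero_or_pos n with rfl | hn
    · simp
    · have hn' : (0 : ℝ) < n := by exact_mod_cast hn
      exact Real.log_le_log hn' (by linarith)
  have hlog := Real.log_nonneg (show (1 : ℝ) ≤ 1 + n by simp)
  have h3 := Real.log_two_lt_d9
  have h4 : S * Real.log 2 ≤ S * 0.7 := by gcongr; linarith
  rw [h8]
  linarith

end Threshold

/-- With `v = √(1 + n)` and `log v ≤ v - 1`, the hypothesis becomes a quadratic inequality giving `v
= O(Y)`. The logarithm of `1 + n` is then twice that of `v`, and the added `1` is absorbed by a
third logarithm. -/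
theorem one_add_log_le_of_self_bounding {n Y X : ℝ} (hn : 0 ≤ n) (hY : 1 ≤ Y) (hYX : Y ≤ X)
    (h : n ≤ 9 * Y * (9 + 4 * Real.log (1 + n))) :
    1 + Real.log (1 + n) ≤ 3 * Real.log (1152 * X) := by
  set v := Real.sqrt (1 + n) with hv
  have hv2 : v ^ 2 = 1 + n := Real.sq_sqrt (by linarith)
  have hv1 : 1 ≤ v := by rw [hv, Real.one_le_sqrt]; linarith
  have hlog : Real.log (1 + n) = 2 * Real.log v := by rw [← hv2, Real.log_pow]; norm_num
  have hlv := Real.log_le_sub_one_of_pos (show 0 < v by linarith)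
  have hvY : v ≤ 154 * Y := by
    rw [hlog] at h
    have h1 : v ^ 2 ≤ Y * (154 * v) := by nlinarith
    nlinarith
  have h2 : Real.log v ≤ Real.log (1152 * X) := Real.log_le_log (by linarith) (by linarith)
  have h3 : 1 ≤ Real.log (1152 * X) := by
    rw [Real.le_log_iff_exp_le (by linarith)]
    linarith [Real.exp_one_lt_d9]
  rw [hlog]
  linarith

end BPIUCRL

/-! ### Minimal visitation probabilities and the conditional return gap. -/

namespace EpisodicMDP

variable {S A : Type*} [Fintype S] [DecidableEq S] [DecidableEq A]
  [MeasurableSpace S] [MeasurableSpace A] {H : ℕ} (M : EpisodicMDP S A H)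

theorem minVisit_le_ofReal {π : Policy S A H} {h : Fin H} {s : S} {a : A}
    (hv : 0 < M.visitProb π h s a) :
    M.minVisit h s a ≤ ENNReal.ofReal (M.visitProb π h s a) :=
  iInf₂_le π hv

theorem minVisit_toReal_le {π : Policy S A H} {h : Fin H} {s : S} {a : A}
    (hv : 0 < M.visitProb π h s a) : (M.minVisit h s a).toReal ≤ M.visitProb π h s a :=
  ENNReal.toReal_le_of_le_ofReal hv.le (M.minVisit_le_ofReal hv)

/-- The policy that reaches the triplet competes in the infimum. The start state makes the supremum
one over a non-empty set, and finiteness of the set of policies bounds the infimum below. -/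
theorem condReturnGap_le [Finite A] [MeasurableSingletonClass S] (hH : 0 < H) {π : Policy S A H} {h : Fin H}
    {s : S} {a : A} (hv : 0 < M.visitProb π h s a) {b : ℝ}
    (hb : ∀ h' s', 0 < M.stateProb π h' s' →
      M.Vstar h'.castSucc s' - M.V π h'.castSucc s' ≤ b) :
    M.condReturnGap h s a ≤ b := by
  have : Nonempty {q : Fin H × S // 0 < M.stateProb π q.1 q.2} :=
    ⟨⟨(⟨0, hH⟩, M.start), by rw [M.stateProb_start]; exact one_pos⟩⟩
  exact (ciInf_le (Set.finite_range _).bddBelow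
    (⟨π, hv⟩ : {π : Policy S A H // 0 < M.visitProb π h s a})).trans
    (ciSup_le fun q => hb _ _ q.2)

variable [Finite A] [Nonempty A]

/-- There are finitely many policies, so the infimum is attained. -/
theorem minVisit_pos (h : Fin H) (s : S) (a : A) : 0 < M.minVisit h s a := by
  obtain ⟨π, hπ⟩ := exists_eq_ciInf_of_finite
    (f := fun π : Policy S A H => ⨅ (_ : 0 < M.visitProb π h s a),
      ENNReal.ofReal (M.visitProb π h s a))
  unfold minVisit
  rw [← hπ]
  by_cases hv : 0 < M.visitProb π h s a <;> simp [hv]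

theorem minVisit_toReal_pos {π : Policy S A H} {h : Fin H} {s : S} {a : A}
    (hv : 0 < M.visitProb π h s a) : 0 < (M.minVisit h s a).toReal :=
  ENNReal.toReal_pos (M.minVisit_pos h s a).ne'
    (ne_top_of_le_ne_top ENNReal.ofReal_ne_top (M.minVisit_le_ofReal hv))

theorem pMin_mem [MeasurableSingletonClass S] (hH : 0 < H) : 0 < M.pMin ∧ M.pMin ≤ 1 := by
  have : Nonempty (Fin H) := ⟨⟨0, hH⟩⟩
  have : Nonempty S := ⟨M.start⟩
  have hpos : 0 < ⨅ (h : Fin H) (s : S) (a : A), M.minVisit h s a := by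
    obtain ⟨h, hh⟩ := exists_eq_ciInf_of_finite
      (f := fun h : Fin H => ⨅ (s : S) (a : A), M.minVisit h s a)
    obtain ⟨s, hs⟩ := exists_eq_ciInf_of_finite (f := fun s : S => ⨅ a : A, M.minVisit h s a)
    obtain ⟨a, ha⟩ := exists_eq_ciInf_of_finite (f := fun a : A => M.minVisit h s a)
    rw [← hh, ← hs, ← ha]
    exact M.minVisit_pos h s a
  have hle : ⨅ (h : Fin H) (s : S) (a : A), M.minVisit h s a ≤ 1 := by
    obtain ⟨π⟩ : Nonempty (Policy S A H) := inferInstance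
    have hv : M.visitProb π ⟨0, hH⟩ M.start (π ⟨0, hH⟩ M.start) = 1 := by
      rw [visitProb, if_pos rfl, M.stateProb_start]
    have h1 := M.minVisit_le_ofReal (by rw [hv]; exact one_pos)
    rw [hv, ENNReal.ofReal_one] at h1
    exact ((iInf_le _ (⟨0, hH⟩ : Fin H)).trans
      ((iInf_le _ M.start).trans (iInf_le _ _))).trans h1
  exact ⟨ENNReal.toReal_pos hpos.ne' (ne_top_of_le_ne_top ENNReal.one_ne_top hle),
    ENNReal.toReal_le_of_le_ofReal zero_le_one (by simpa using hle)⟩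

end EpisodicMDP

/-! ### Unstopped episodes reach a wide triplet. -/

namespace BPIUCRL

section Exploration

variable {S A : Type*} [Fintype S] [DecidableEq S]
  [MeasurableSpace S] [MeasurableSingletonClass S] [MeasurableSpace A] {H : ℕ}
  {M : EpisodicMDP S A H}

/-- Unrolling a one-step recursion along the states that `π` reaches. -/
theorem le_of_recursion_of_reachable {π : Policy S A H} {D : Fin (H + 1) → S → ℝ}
    {w : Fin H → S → ℝ} {κ : ℝ} (hκ : 0 ≤ κ) (hlast : ∀ s, D (Fin.last H) s = 0)
    (hstep : ∀ (h : Fin H) s, D h.castSucc s ≤ 3 * (((H : ℝ) - (h : ℕ)) * w h s) +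
      ∑ s', M.p h s (π h s) s' * D h.succ s')
    (hw : ∀ h s, 0 < M.stateProb π h s → w h s ≤ κ) (i : Fin (H + 1)) (s : S)
    (hs : ∀ h : Fin H, i = h.castSucc → 0 < M.stateProb π h s) :
    D i s ≤ 3 * H * κ * ((H : ℝ) - (i : ℕ)) := by
  induction i using Fin.reverseInduction generalizing s with
  | last => simp [hlast]
  | cast h ih =>
    have hreach := hs h rfl
    have h1 : ∑ s', M.p h s (π h s) s' * D h.succ s' ≤
        ∑ s', M.p h s (π h s) s' * (3 * H * κ * ((H : ℝ) - (h.succ : ℕ))) := by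
      refine Finset.sum_le_sum fun s' _ => ?_
      -- Transitions of probability zero drop out, so the induction hypothesis is needed only at
      -- reachable states.
      rcases (M.p_nonneg h s (π h s) s').eq_or_lt with h0 | h0
      · simp [← h0]
      · exact mul_le_mul_of_nonneg_left (ih s' fun h' hh' =>
          M.stateProb_pos_of_transition π h h' hh' s s' hreach h0) h0.le
    rw [← Finset.sum_mul, M.p_sum, one_mul] at h1
    have h2 : ((H : ℝ) - (h : ℕ)) * w h s ≤ H * κ := by
      have hh : ((h : ℕ) : ℝ) ≤ H := by exact_mod_cast h.is_lt.le
      have h0 : (0 : ℝ) ≤ (h : ℕ) := Nat.cast_nonneg _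
      calc _ ≤ ((H : ℝ) - (h : ℕ)) * κ :=
            mul_le_mul_of_nonneg_left (hw h s hreach) (by linarith)
        _ ≤ H * κ := by gcongr; linarith
    have h3 := hstep h s
    simp only [Fin.val_succ, Nat.cast_add, Nat.cast_one, Fin.val_castSucc] at *
    linarith

variable [DecidableEq A] [Finite A] [Nonempty A] {β : ℕ → ℝ} {x : ℕ → Episode S A H} {t : ℕ}

/-- As long as the stopping rule is not met, some reachable triplet has a large width. -/
theorem Accurate.exists_wide_triplet (hacc : Accurate M β x t) (hH : 0 < H) {π : Policy S A H}
    (hπ : IsGreedy (upperQ β x t) π) {ε : ℝ}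
    (hε : ε < upperV β x t 0 M.start - lowerV β x t 0 M.start) :
    ∃ q : Fin H × S × A, 0 < M.visitProb π q.1 q.2.1 q.2.2 ∧
      max (M.condReturnGap q.1 q.2.1 q.2.2) ε ≤ 3 * H ^ 2 * width β x t q.1 q.2.1 q.2.2 := by
  classical
  -- The witness is the widest state-action pair that `π` reaches; the same one serves for the gap
  -- and for `ε`.
  obtain ⟨q, hq, hmax⟩ := Finset.exists_max_image
    (Finset.univ.filter fun q : Fin H × S => 0 < M.stateProb π q.1 q.2)
    (fun q => width β x t q.1 q.2 (π q.1 q.2))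
    ⟨(⟨0, hH⟩, M.start), by simp [M.stateProb_start]⟩
  simp only [Finset.mem_filter, Finset.mem_univ, true_and] at hq hmax
  have hv : 0 < M.visitProb π q.1 q.2 (π q.1 q.2) := by
    rw [EpisodicMDP.visitProb, if_pos rfl]
    exact hq
  set κ := width β x t q.1 q.2 (π q.1 q.2) with hκ
  have hκ0 : 0 ≤ κ := width_nonneg _ _ _ _ _ _
  have hw : ∀ h s, 0 < M.stateProb π h s → width β x t h s (π h s) ≤ κ :=
    fun h s hs => hmax (h, s) hs
  have hbound : ∀ i : Fin (H + 1), 3 * H * κ * ((H : ℝ) - (i : ℕ)) ≤ 3 * H ^ 2 * κ := by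
    intro i
    have : (0 : ℝ) ≤ 3 * H * κ * (i : ℕ) := by positivity
    nlinarith
  refine ⟨(q.1, q.2, π q.1 q.2), hv, max_le ?_ ?_⟩
  · refine M.condReturnGap_le hH hv fun h' s' hs' => ?_
    have h1 := le_of_recursion_of_reachable (M := M) (π := π)
      (D := fun i s => upperV β x t i s - M.V π i s) (w := fun h s => width β x t h s (π h s)) hκ0
      (fun s => by simp [upperV_last, M.V_last]) (hacc.upperV_sub_V_le hπ) hw h'.castSucc s'
      (fun h hh => by rwa [← Fin.castSucc_injective H hh])
    have h2 := hacc.Vstar_le_upperV h'.castSucc s'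
    linarith [hbound h'.castSucc]
  · have h1 := le_of_recursion_of_reachable (M := M) (π := π)
      (D := fun i s => upperV β x t i s - lowerV β x t i s)
      (w := fun h s => width β x t h s (π h s)) hκ0
      (fun s => by simp [upperV_last, lowerV_last]) (hacc.upperV_sub_lowerV_le hπ) hw 0 M.start
      (fun h hh => by
        obtain rfl : h = ⟨0, hH⟩ := Fin.castSucc_injective H hh.symm
        rw [M.stateProb_start]; exact one_pos)
    linarith [hbound 0]

end Exploration

end BPIUCRL

/-! ### Probability of the good event and the counting argument. -/

namespace BPIUCRL

section GoodEvent

variable {S A : Type*} [Fintype S] [Fintype A] [DecidableEq S] [DecidableEq A]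
  [MeasurableSpace S] [MeasurableSpace A] {H : ℕ}

/-- The estimates are accurate at all times, and the visit counts follow the sums of the visitation
probabilities, up to the confidence level `L`. -/
structure IsGood (M : EpisodicMDP S A H) (β : ℕ → ℝ) (L : ℝ) (π : ℕ → Policy S A H)
    (x : ℕ → Episode S A H) : Prop where
  accurate : ∀ t, Accurate M β x t
  visits : ∀ t h s a,
    (∑ j ∈ Finset.range t, M.visitProb (π j) h s a) / 2 ≤ count x t h s a + L

theorem IsRun.measure_not_isGood_le [MeasurableSingletonClass S] [MeasurableSingletonClass A]
    [Nonempty A] (hH : 0 < H) {M : EpisodicMDP S A H} {δ : ℝ} (hδ : 0 < δ) (hδ1 : δ < 1)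
    {β : ℕ → ℝ} (hβ : β = beta (Fintype.card S) (Fintype.card A) H δ)
    {Ω : Type*} [mΩ : MeasurableSpace Ω] {μ : Measure Ω} [IsProbabilityMeasure μ]
    {F : Filtration ℕ mΩ} {π : ℕ → Ω → Policy S A H} {x : ℕ → Ω → Episode S A H}
    (hrun : IsRun M β μ F π x) :
    μ {ω | ¬ IsGood M β (Real.log (3 * Fintype.card S * Fintype.card A * H / δ))
      (fun j => π j ω) (fun j => x j ω)} ≤ ENNReal.ofReal δ := by
  have : Nonempty S := ⟨M.start⟩
  have hS : 1 ≤ Fintype.card S := Fintype.card_pos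
  have hA : 1 ≤ Fintype.card A := Fintype.card_pos
  have hS' : (1 : ℝ) ≤ Fintype.card S := by exact_mod_cast hS
  have hA' : (1 : ℝ) ≤ Fintype.card A := by exact_mod_cast hA
  have hH' : (1 : ℝ) ≤ H := by exact_mod_cast hH
  set L := Real.log (3 * Fintype.card S * Fintype.card A * H / δ) with hL
  have hL1 : 1 ≤ L := one_le_log_confidence hS hA hH hδ hδ1
  set N : ℝ := 3 * Fintype.card S * Fintype.card A * H with hN
  have hN1 : 1 ≤ N := by
    have : (1 : ℝ) ≤ Fintype.card S * Fintype.card A * H := one_le_mul_of_one_le_of_one_le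
      (one_le_mul_of_one_le_of_one_le hS' hA') hH'
    rw [hN]; nlinarith
  have hα : 0 < δ / N := by positivity
  have hα1 : δ / N ≤ 1 := by rw [div_le_one (by positivity)]; linarith
  have h2S : (1 : ℝ) ≤ 2 ^ Fintype.card S := one_le_pow₀ (by norm_num)
  have hαB : 0 < δ / N / 2 ^ Fintype.card S := by positivity
  have hαB1 : δ / N / 2 ^ Fintype.card S ≤ 1 := by
    rw [div_le_one (by positivity)]; linarith
  have hlogα : Real.log (1 / (δ / N)) = L := by rw [one_div_div]
  -- Each triplet has three failure modes of budget `δ / N`; sharing the one for transitions among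
  -- the `2^S` sets of states adds `S log 2` to the level.
  have hlogαB : Real.log (1 / (δ / N / 2 ^ Fintype.card S)) =
      L + Fintype.card S * Real.log 2 := by
    rw [one_div_div, ← Real.log_pow, hL, ← Real.log_mul (by positivity) (by positivity)]
    congr 1
    field_simp
  have hlevel : ∀ n : ℕ, 9 / 16 * (L + Fintype.card S * Real.log 2 + Real.log 8 +
      1 / 2 * Real.log n) ≤ β n := fun n => by
    rw [hβ]
    exact deviation_level_le_beta hS hL1 n
  have hlevel' : ∀ n : ℕ, 9 / 16 * (L + Real.log 8 + 1 / 2 * Real.log n) ≤ β n := fun n => by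
    refine le_trans ?_ (hlevel n)
    have : 0 ≤ Fintype.card S * Real.log 2 := by positivity
    linarith
  set bad : Fin H × S × A → Set Ω := fun q =>
    {ω | ∃ t, ¬ ((∑ j ∈ Finset.range t,
      if (x j ω).1 q.1.castSucc = q.2.1 ∧ (x j ω).2.1 q.1 = q.2.2
      then (x j ω).2.2 q.1 - M.r q.1 q.2.1 q.2.2 else 0) ^ 2 ≤
        (count (fun j => x j ω) t q.1 q.2.1 q.2.2 : ℝ) *
        (9 / 16 * (Real.log (1 / (δ / N)) + Real.log 8 +
          1 / 2 * Real.log (count (fun j => x j ω) t q.1 q.2.1 q.2.2))))} ∪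
    ((⋃ B : Finset S, {ω | ∃ t, ¬ ((∑ j ∈ Finset.range t,
      if (x j ω).1 q.1.castSucc = q.2.1 ∧ (x j ω).2.1 q.1 = q.2.2
      then (if (x j ω).1 q.1.succ ∈ B then 1 else 0) - ∑ s' ∈ B, M.p q.1 q.2.1 q.2.2 s'
      else 0) ^ 2 ≤ (count (fun j => x j ω) t q.1 q.2.1 q.2.2 : ℝ) *
        (9 / 16 * (Real.log (1 / (δ / N / 2 ^ Fintype.card S)) + Real.log 8 +
          1 / 2 * Real.log (count (fun j => x j ω) t q.1 q.2.1 q.2.2))))}) ∪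
    {ω | ∃ t, ¬ ((∑ j ∈ Finset.range t, M.visitProb (π j ω) q.1 q.2.1 q.2.2) / 2 ≤
      count (fun j => x j ω) t q.1 q.2.1 q.2.2 + Real.log (1 / (δ / N)))}) with hbad
  have hbadle : ∀ q, μ (bad q) ≤ ENNReal.ofReal (3 * (δ / N)) := by
    intro q
    have hB : μ (⋃ B : Finset S, {ω | ∃ t, ¬ ((∑ j ∈ Finset.range t,
        if (x j ω).1 q.1.castSucc = q.2.1 ∧ (x j ω).2.1 q.1 = q.2.2
        then (if (x j ω).1 q.1.succ ∈ B then 1 else 0) - ∑ s' ∈ B, M.p q.1 q.2.1 q.2.2 s'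
        else 0) ^ 2 ≤ (count (fun j => x j ω) t q.1 q.2.1 q.2.2 : ℝ) *
          (9 / 16 * (Real.log (1 / (δ / N / 2 ^ Fintype.card S)) + Real.log 8 +
            1 / 2 * Real.log (count (fun j => x j ω) t q.1 q.2.1 q.2.2))))}) ≤
        ENNReal.ofReal (δ / N) := by
      refine (measure_iUnion_fintype_le _ _).trans ((Finset.sum_le_sum fun B _ =>
        hrun.measure_transition_deviation_le q.1 q.2.1 q.2.2 B hαB hαB1).trans (le_of_eq ?_))
      rw [← ENNReal.ofReal_sum_of_nonneg fun _ _ => hαB.le]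
      congr 1
      simp only [Finset.sum_const, Finset.card_univ, Fintype.card_finset, nsmul_eq_mul]
      push_cast
      field_simp
    have h3 : ENNReal.ofReal (3 * (δ / N)) =
        ENNReal.ofReal (δ / N) + (ENNReal.ofReal (δ / N) + ENNReal.ofReal (δ / N)) := by
      rw [← ENNReal.ofReal_add hα.le hα.le, ← ENNReal.ofReal_add hα.le (by positivity)]
      congr 1; ring
    rw [h3]
    exact (measure_union_le _ _).trans (add_le_add
      (hrun.measure_reward_deviation_le q.1 q.2.1 q.2.2 hα hα1) ((measure_union_le _ _).trans
      (add_le_add hB (hrun.measure_count_deviation_le q.1 q.2.1 q.2.2 hα))))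
  have hnull : μ {ω | ¬ ∀ j h, (x j ω).2.2 h ∈ Set.Icc (0 : ℝ) 1} = 0 := hrun.ae_reward_mem_Icc
  have hsub : {ω | ¬ IsGood M β L (fun j => π j ω) (fun j => x j ω)} ⊆
      {ω | ¬ ∀ j h, (x j ω).2.2 h ∈ Set.Icc (0 : ℝ) 1} ∪ ⋃ q, bad q := by
    intro ω hω
    by_contra hc
    simp only [hbad, Set.mem_union, Set.mem_iUnion, Set.mem_ofPred_eq, not_or, not_exists,
      not_not] at hc
    obtain ⟨hx, hq⟩ := hc
    refine hω ⟨fun t => Accurate.of_deviation hx (fun h s a => ?_) (fun h s a B => ?_),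
      fun t h s a => ?_⟩
    · refine ((hq (h, s, a)).1 t).trans ?_
      rw [hlogα]
      exact mul_le_mul_of_nonneg_left (hlevel' _) (Nat.cast_nonneg _)
    · refine ((hq (h, s, a)).2.1 B t).trans ?_
      rw [hlogαB]
      exact mul_le_mul_of_nonneg_left (hlevel _) (Nat.cast_nonneg _)
    · have := (hq (h, s, a)).2.2 t
      rwa [hlogα] at this
  refine (measure_mono hsub).trans ((measure_union_le _ _).trans ?_)
  rw [hnull, zero_add]
  refine (measure_iUnion_fintype_le _ _).trans
    ((Finset.sum_le_sum fun q _ => hbadle q).trans (le_of_eq ?_))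
  rw [← ENNReal.ofReal_sum_of_nonneg fun _ _ => by positivity]
  congr 1
  simp only [Finset.sum_const, Finset.card_univ, Fintype.card_prod, Fintype.card_fin, nsmul_eq_mul]
  push_cast
  rw [hN]
  field_simp

end GoodEvent

theorem stoppingTime_eq_of_minimal {S A : Type*} [Fintype S] [DecidableEq S] [DecidableEq A] {H : ℕ}
    {β : ℕ → ℝ} {ε : ℝ} {x : ℕ → Episode S A H} {s₁ : S} {T : ℕ}
    (hT : upperV β x T 0 s₁ - lowerV β x T 0 s₁ ≤ ε)
    (hmin : ∀ t < T, ε < upperV β x t 0 s₁ - lowerV β x t 0 s₁) :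
    stoppingTime β s₁ ε x = T := by
  refine le_antisymm (iInf₂_le T hT) (le_iInf₂ fun t ht => ?_)
  by_contra hlt
  exact absurd ht (not_le.2 (hmin t (by simpa using hlt)))

section SampleComplexity

variable {S A : Type*} [Fintype S] [Fintype A] [Nonempty A] [DecidableEq S] [DecidableEq A]
  [MeasurableSpace S] [MeasurableSingletonClass S] [MeasurableSpace A] {H : ℕ}
  {M : EpisodicMDP S A H} {δ ε L : ℝ} {β : ℕ → ℝ} {π : ℕ → Policy S A H}
  {x : ℕ → Episode S A H}

/-- Bound on the number of visits of a triplet at a time when its width is large. -/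
theorem count_bound_of_wide (hH : 0 < H) (hε : 0 < ε) (hεH : ε ≤ H) (hL1 : 1 ≤ L)
    (hL : L = Real.log (3 * Fintype.card S * Fintype.card A * H / δ))
    (hβ : β = beta (Fintype.card S) (Fintype.card A) H δ) {t : ℕ} {h : Fin H} {s : S} {a : A}
    {m : ℝ} (hm : ε ≤ m) (hwide : m ≤ 3 * H ^ 2 * width β x t h s a) :
    (2 * (count x t h s a + L) + 1) * m ^ 2 ≤ H ^ 4 * (720 * L + 1729 * Fintype.card S *
      Real.log (1152 * ((Fintype.card S : ℝ) ^ 2 * Fintype.card A * (H : ℝ) ^ 5 /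
        (M.pMin * ε ^ 2)) * L)) := by
  have : Nonempty S := ⟨M.start⟩
  have hS : 1 ≤ Fintype.card S := Fintype.card_pos
  have hA' : (1 : ℝ) ≤ Fintype.card A := by exact_mod_cast Fintype.card_pos (α := A)
  have hS' : (1 : ℝ) ≤ Fintype.card S := by exact_mod_cast hS
  have hH' : (1 : ℝ) ≤ H := by exact_mod_cast hH
  obtain ⟨hp0, hp1⟩ := M.pMin_mem hH
  subst hβ
  have hβle := beta_le (A := Fintype.card A) (H := H) (δ := δ) hS (hL ▸ hL1) (count x t h s a)
  have hβ0 : ∀ n, 0 ≤ beta (Fintype.card S) (Fintype.card A) H δ n := fun n => sq_nonneg _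
  have hw := count_mul_width_sq_le hβ0 x t h s a
  have hw0 := width_nonneg (beta (Fintype.card S) (Fintype.card A) H δ) x t h s a
  have hw1 := width_le_one (beta (Fintype.card S) (Fintype.card A) H δ) x t h s a
  rw [← hL] at hβle
  generalize width (beta (Fintype.card S) (Fintype.card A) H δ) x t h s a = w at *
  generalize (beta (Fintype.card S) (Fintype.card A) H δ (count x t h s a)) = b at *
  have hn0 : (0 : ℝ) ≤ count x t h s a := Nat.cast_nonneg _
  generalize (count x t h s a : ℝ) = n at *
  generalize (Fintype.card A : ℝ) = cA at *
  generalize (Fintype.card S : ℝ) = cS at *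
  generalize (H : ℝ) = η at *
  generalize M.pMin = p at *
  have hlog0 : 0 ≤ Real.log (1 + n) := Real.log_nonneg (by linarith)
  have hm0 : 0 < m := hε.trans_le hm
  have hm2 : m ^ 2 ≤ 9 * η ^ 4 * w ^ 2 := by
    calc m ^ 2 ≤ (3 * η ^ 2 * w) ^ 2 := by gcongr
      _ = 9 * η ^ 4 * w ^ 2 := by ring
  have hm2' : m ^ 2 ≤ 9 * η ^ 4 := by
    have : w ^ 2 ≤ 1 := pow_le_one₀ hw0 hw1
    nlinarith [pow_pos (show 0 < η by linarith) 4]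
  have hnm : n * m ^ 2 ≤ 9 * η ^ 4 * b := by
    calc n * m ^ 2 ≤ n * (9 * η ^ 4 * w ^ 2) := by gcongr
      _ = 9 * η ^ 4 * (n * w ^ 2) := by ring
      _ ≤ 9 * η ^ 4 * b := by gcongr
  -- `Y` is the natural scale of the count; the `X` of the statement exceeds it by the factor `S A H
  -- / p_min ≥ 1`.
  set Y := η ^ 4 * cS * L / ε ^ 2 with hY
  set X := cS ^ 2 * cA * η ^ 5 / (p * ε ^ 2) * L with hX
  have hη4 : ε ^ 2 ≤ η ^ 4 := by
    calc ε ^ 2 ≤ η ^ 2 := by gcongr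
      _ ≤ η ^ 4 := pow_le_pow_right₀ hH' (by norm_num)
  have hY1 : 1 ≤ Y := by
    rw [hY, one_le_div (by positivity)]
    have : 1 ≤ cS * L := one_le_mul_of_one_le_of_one_le hS' hL1
    nlinarith
  have hYX : Y ≤ X := by
    have e : X = Y * (cS * cA * η / p) := by
      rw [hX, hY]; field_simp
    rw [e]
    refine le_mul_of_one_le_right (by linarith) ?_
    rw [one_le_div hp0]
    exact hp1.trans (one_le_mul_of_one_le_of_one_le (one_le_mul_of_one_le_of_one_le hS' hA') hH')
  have hself : n ≤ 9 * Y * (9 + 4 * Real.log (1 + n)) := by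
    have h1 : n * ε ^ 2 ≤ 9 * η ^ 4 * (cS * L * (9 + 4 * Real.log (1 + n))) := by
      calc n * ε ^ 2 ≤ n * m ^ 2 := by gcongr
        _ ≤ 9 * η ^ 4 * b := hnm
        _ ≤ _ := by
          gcongr
          refine hβle.trans ?_
          have h2 : L ≤ cS * L := le_mul_of_one_le_left (by linarith) hS'
          have h3 : cS * (1 + Real.log (1 + n)) ≤ cS * L * (1 + Real.log (1 + n)) := by
            gcongr
            exact le_mul_of_one_le_right (by linarith) hL1
          linarith
    rw [show 9 * Y * (9 + 4 * Real.log (1 + n)) =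
      9 * η ^ 4 * (cS * L * (9 + 4 * Real.log (1 + n))) / ε ^ 2 by rw [hY]; ring,
      le_div_iff₀ (by positivity)]
    exact h1
  have hlog := one_add_log_le_of_self_bounding hn0 hY1 hYX hself
  have hlogX : 0 ≤ Real.log (1152 * X) := Real.log_nonneg (by linarith)
  have hX' : 1152 * (cS ^ 2 * cA * η ^ 5 / (p * ε ^ 2)) * L = 1152 * X := by rw [hX]; ring
  rw [hX']
  -- The estimates yield `117 L + 216 S log (1152 X)`, well within the stated constants.
  calc (2 * (n + L) + 1) * m ^ 2 = 2 * (n * m ^ 2) + (2 * L + 1) * m ^ 2 := by ring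
    _ ≤ 2 * (9 * η ^ 4 * b) + (2 * L + 1) * (9 * η ^ 4) := by gcongr
    _ = η ^ 4 * (18 * b + 9 * (2 * L + 1)) := by ring
    _ ≤ _ := by
      refine mul_le_mul_of_nonneg_left ?_ (by positivity)
      have h2 : cS * (1 + Real.log (1 + n)) ≤ cS * (3 * Real.log (1152 * X)) := by gcongr
      have h3 : 0 ≤ cS * Real.log (1152 * X) := by positivity
      linarith

/-- Charge each of the `N` episodes to a wide triplet it may visit, and bound the number of charges
of each triplet at the last of them. -/
theorem IsGood.le_of_forall_not_stopped (hgood : IsGood M β L π x)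
    (hgreedy : ∀ t, IsGreedy (upperQ β x t) (π t)) (hH : 0 < H) (hε : 0 < ε) (hεH : ε ≤ H)
    (hL1 : 1 ≤ L) (hL : L = Real.log (3 * Fintype.card S * Fintype.card A * H / δ))
    (hβ : β = beta (Fintype.card S) (Fintype.card A) H δ) {N : ℕ}
    (hN : ∀ t < N, ε < upperV β x t 0 M.start - lowerV β x t 0 M.start) :
    (N : ℝ) ≤ (H : ℝ) ^ 4 * ∑ h : Fin H, ∑ s : S, ∑ a : A,
      (720 * L + 1729 * Fintype.card S * Real.log (1152 * ((Fintype.card S : ℝ) ^ 2 *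
        Fintype.card A * (H : ℝ) ^ 5 / (M.pMin * ε ^ 2)) * L)) *
        ((M.minVisit h s a)⁻¹).toReal / (max (M.condReturnGap h s a) ε) ^ 2 := by
  set C := 720 * L + 1729 * Fintype.card S * Real.log (1152 * ((Fintype.card S : ℝ) ^ 2 *
        Fintype.card A * (H : ℝ) ^ 5 / (M.pMin * ε ^ 2)) * L) with hC
  have hwide : ∀ t, ∃ q : Fin H × S × A, t < N → 0 < M.visitProb (π t) q.1 q.2.1 q.2.2 ∧
      max (M.condReturnGap q.1 q.2.1 q.2.2) ε ≤ 3 * H ^ 2 * width β x t q.1 q.2.1 q.2.2 := by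
    intro t
    by_cases ht : t < N
    · obtain ⟨q, hq⟩ := (hgood.accurate t).exists_wide_triplet hH (hgreedy t) (hN t ht)
      exact ⟨q, fun _ => hq⟩
    · exact ⟨(⟨0, hH⟩, M.start, Classical.arbitrary A), fun h => (ht h).elim⟩
  choose tr htr using hwide
  have hcard : N = ∑ q : Fin H × S × A, ((Finset.range N).filter fun t => tr t = q).card := by
    rw [← Finset.card_eq_sum_card_fiberwise (fun _ _ => Finset.mem_coe.2 (Finset.mem_univ _)),
      Finset.card_range]
  have hfiber : ∀ q : Fin H × S × A, (((Finset.range N).filter fun t => tr t = q).card : ℝ) ≤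
      H ^ 4 * (C * ((M.minVisit q.1 q.2.1 q.2.2)⁻¹).toReal /
        (max (M.condReturnGap q.1 q.2.1 q.2.2) ε) ^ 2) := by
    rintro ⟨h, s, a⟩
    set m := max (M.condReturnGap h s a) ε with hm
    have hm0 : 0 < m := hε.trans_le (le_max_right _ _)
    set T := (Finset.range N).filter fun t => tr t = (h, s, a) with hT
    rcases T.eq_empty_or_nonempty with hempty | hne
    · rw [hempty, Finset.card_empty, Nat.cast_zero]
      -- Uncharged triplets, including the unreachable ones, only need a nonnegative bound. The sign
      -- of `C` is read off from the count bound at time `0`, where the width is `1` and `ε ≤ H ≤ 3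
      -- H²`.
      have hC0 : 0 ≤ C := by
        have : Nonempty S := ⟨M.start⟩
        obtain ⟨hp0, hp1⟩ := M.pMin_mem hH
        have hb := count_bound_of_wide (M := M) (x := fun _ => (fun _ => M.start,
          fun _ => Classical.arbitrary A, fun _ => 0)) (t := 0) (h := h) (s := s) (a := a)
          (m := ε) hH hε hεH hL1 hL hβ le_rfl (by
            have hH' : (1 : ℝ) ≤ H := by exact_mod_cast hH
            simp only [width, BPIUCRL.count, Finset.range_zero, Finset.sum_empty, if_true]
            nlinarith)
        rw [← hC] at hb
        have h4 : (0 : ℝ) < (H : ℝ) ^ 4 := by positivity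
        refine nonneg_of_mul_nonneg_right (le_trans ?_ hb) h4
        positivity
      positivity
    · set t := T.max' hne with ht
      have htT : t ∈ T := T.max'_mem hne
      have htN : t < N ∧ tr t = (h, s, a) := by simpa [hT] using htT
      have hmem : ∀ j ∈ T, 0 < M.visitProb (π j) h s a := by
        intro j hj
        have hj' : j < N ∧ tr j = (h, s, a) := by simpa [hT] using hj
        have := (htr j hj'.1).1
        rwa [hj'.2] at this
      have hw := (htr t htN.1).2
      rw [htN.2] at hw
      have hpm0 := M.minVisit_toReal_pos (hmem t htT)
      have hpm1 : (M.minVisit h s a).toReal ≤ 1 :=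
        (M.minVisit_toReal_le (hmem t htT)).trans (M.visitProb_le_one _ _ _ _)
      set pm := (M.minVisit h s a).toReal with hpm
      -- Counts before episode `t` do not include `t` itself; this last charge is paid for by `pm ≤
      -- 1`, hence the `+ 1` in the count bound.
      have hsum : ((T.card : ℝ) - 1) * pm ≤ ∑ j ∈ Finset.range t, M.visitProb (π j) h s a := by
        calc ((T.card : ℝ) - 1) * pm = ∑ j ∈ T.erase t, pm := by
              rw [Finset.sum_const, Finset.card_erase_of_mem htT, nsmul_eq_mul,
                Nat.cast_sub (Finset.card_pos.2 hne), Nat.cast_one]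
          _ ≤ ∑ j ∈ T.erase t, M.visitProb (π j) h s a := Finset.sum_le_sum fun j hj =>
              M.minVisit_toReal_le (hmem j (Finset.mem_of_mem_erase hj))
          _ ≤ _ := by
              refine Finset.sum_le_sum_of_subset_of_nonneg (fun j hj => ?_)
                fun j _ _ => M.visitProb_nonneg _ _ _ _
              rw [Finset.mem_range]
              exact lt_of_le_of_ne (T.le_max' j (Finset.mem_of_mem_erase hj))
                (Finset.ne_of_mem_erase hj)
      have hcount := hgood.visits t h s a
      have hbound := count_bound_of_wide (M := M) hH hε hεH hL1 hL hβ (le_max_right _ _) hw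
      rw [← hC] at hbound
      rw [ENNReal.toReal_inv, ← hpm]
      have h1 : (T.card : ℝ) * pm ≤ 2 * (count x t h s a + L) + 1 := by linarith
      have h2 : (T.card : ℝ) * pm * m ^ 2 ≤ H ^ 4 * C :=
        (mul_le_mul_of_nonneg_right h1 (sq_nonneg m)).trans hbound
      rw [show (H : ℝ) ^ 4 * (C * pm⁻¹ / m ^ 2) = H ^ 4 * C / (pm * m ^ 2) by field_simp,
        le_div_iff₀ (by positivity)]
      linarith
  have hfinal : (N : ℝ) ≤ ∑ q : Fin H × S × A, H ^ 4 *
      (C * ((M.minVisit q.1 q.2.1 q.2.2)⁻¹).toReal /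
        (max (M.condReturnGap q.1 q.2.1 q.2.2) ε) ^ 2) := by
    conv_lhs => rw [hcard]
    push_cast
    exact Finset.sum_le_sum fun q _ => hfiber q
  rw [← Finset.mul_sum] at hfinal
  simpa only [Fintype.sum_prod_type] using hfinal

end SampleComplexity

end BPIUCRL

/-! ### Conclusion. -/

theorem theorem1 {S A : Type*} [Fintype S] [Fintype A] [Nonempty A] [DecidableEq S] [DecidableEq A]
    [MeasurableSpace S] [MeasurableSingletonClass S]
    [MeasurableSpace A] [MeasurableSingletonClass A]
    {H : ℕ} (hH : 0 < H) (M : EpisodicMDP S A H) (ε δ : ℝ) (hε : 0 < ε) (hδ : 0 < δ) (hδ1 : δ < 1)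
    (β : ℕ → ℝ) (hβ : β = BPIUCRL.beta (Fintype.card S) (Fintype.card A) H δ)
    {Ω : Type*} [mΩ : MeasurableSpace Ω] (μ : Measure Ω) [IsProbabilityMeasure μ]
    (F : Filtration ℕ mΩ) (π : ℕ → Ω → Policy S A H) (x : ℕ → Ω → Episode S A H)
    (hrun : BPIUCRL.IsRun M β μ F π x)
    (cS cA L : ℝ) (hcS : cS = Fintype.card S) (hcA : cA = Fintype.card A)
    (hL : L = Real.log (3 * cS * cA * H / δ)) :
    ENNReal.ofReal (1 - δ) ≤ μ {ω | ∃ T : ℕ,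
      BPIUCRL.stoppingTime β M.start ε (fun j => x j ω) = T ∧
      (∀ πhat : Policy S A H, BPIUCRL.IsGreedy (BPIUCRL.lowerQ β (fun j => x j ω) T) πhat →
        M.Vstar 0 M.start - ε ≤ M.V πhat 0 M.start) ∧
      (ε ≤ H → (T : ℝ) ≤ (H : ℝ) ^ 4 * ∑ h : Fin H, ∑ s : S, ∑ a : A,
        (720 * L +
            1729 * cS * Real.log (1152 * (cS ^ 2 * cA * (H : ℝ) ^ 5 / (M.pMin * ε ^ 2)) * L)) *
          ((M.minVisit h s a)⁻¹).toReal / (max (M.condReturnGap h s a) ε) ^ 2)} := by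
  subst hcS hcA
  have hS : 1 ≤ Fintype.card S := Fintype.card_pos_iff.2 ⟨M.start⟩
  have hL1 : 1 ≤ L := hL ▸ BPIUCRL.one_le_log_confidence hS Fintype.card_pos hH hδ hδ1
  have hbad := hrun.measure_not_isGood_le hH hδ hδ1 hβ
  rw [← hL] at hbad
  have hsub : {ω | BPIUCRL.IsGood M β L (fun j => π j ω) (fun j => x j ω)} ⊆ {ω | ∃ T : ℕ,
      BPIUCRL.stoppingTime β M.start ε (fun j => x j ω) = T ∧
      (∀ πhat : Policy S A H, BPIUCRL.IsGreedy (BPIUCRL.lowerQ β (fun j => x j ω) T) πhat →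
        M.Vstar 0 M.start - ε ≤ M.V πhat 0 M.start) ∧
      (ε ≤ H → (T : ℝ) ≤ (H : ℝ) ^ 4 * ∑ h : Fin H, ∑ s : S, ∑ a : A,
        (720 * L + 1729 * (Fintype.card S : ℝ) * Real.log (1152 * ((Fintype.card S : ℝ) ^ 2 *
            (Fintype.card A : ℝ) * (H : ℝ) ^ 5 / (M.pMin * ε ^ 2)) * L)) *
          ((M.minVisit h s a)⁻¹).toReal / (max (M.condReturnGap h s a) ε) ^ 2)} := by
    intro ω hgood
    have hgreedy := fun t => hrun.greedy t ω
    have hex : ∃ t, BPIUCRL.upperV β (fun j => x j ω) t 0 M.start -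
        BPIUCRL.lowerV β (fun j => x j ω) t 0 M.start ≤ ε := by
      by_cases hεH : ε ≤ H
      -- If the rule never fired, the sample complexity bound would hold for every `N`.
      · by_contra! hnot
        obtain ⟨N, hN⟩ := exists_nat_gt ((H : ℝ) ^ 4 * ∑ h : Fin H, ∑ s : S, ∑ a : A,
          (720 * L + 1729 * (Fintype.card S : ℝ) * Real.log (1152 * ((Fintype.card S : ℝ) ^ 2 *
            (Fintype.card A : ℝ) * (H : ℝ) ^ 5 / (M.pMin * ε ^ 2)) * L)) *
          ((M.minVisit h s a)⁻¹).toReal / (max (M.condReturnGap h s a) ε) ^ 2)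
        exact absurd (hgood.le_of_forall_not_stopped hgreedy hH hε hεH hL1 hL hβ
          (N := N) fun t _ => hnot t) (not_le.2 hN)
      -- The initial gap is at most `H < ε`, so the rule fires before any episode.
      · refine ⟨0, ?_⟩
        have h1 := BPIUCRL.upperV_le (β := β) (x := fun j => x j ω) (t := 0) 0 M.start
        have h2 := BPIUCRL.lowerV_nonneg (β := β) (x := fun j => x j ω) (t := 0) 0 M.start
        simp only [Fin.val_zero, Nat.cast_zero, sub_zero] at h1
        linarith
    classical
    have hmin : ∀ t < Nat.find hex, ε < BPIUCRL.upperV β (fun j => x j ω) t 0 M.start -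
        BPIUCRL.lowerV β (fun j => x j ω) t 0 M.start := fun t ht => not_le.1 (Nat.find_min hex ht)
    refine ⟨Nat.find hex, BPIUCRL.stoppingTime_eq_of_minimal (Nat.find_spec hex) hmin,
      fun πhat hπhat => ?_, fun hεH =>
        hgood.le_of_forall_not_stopped hgreedy hH hε hεH hL1 hL hβ hmin⟩
    have hacc := hgood.accurate (Nat.find hex)
    have h1 := hacc.Vstar_le_upperV 0 M.start
    have h2 := hacc.lowerV_le_V hπhat 0 M.start
    have h3 := Nat.find_spec hex
    linarith
  refine le_trans ?_ (measure_mono hsub)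
  rw [ENNReal.ofReal_sub 1 hδ.le, ENNReal.ofReal_one, tsub_le_iff_right]
  -- Subadditivity suffices, so the good event need not be shown measurable.
  have huniv := measure_union_le (μ := μ)
    {ω | BPIUCRL.IsGood M β L (fun j => π j ω) (fun j => x j ω)}
    {ω | ¬ BPIUCRL.IsGood M β L (fun j => π j ω) (fun j => x j ω)}
  rw [show {ω | BPIUCRL.IsGood M β L (fun j => π j ω) (fun j => x j ω)} ∪
    {ω | ¬ BPIUCRL.IsGood M β L (fun j => π j ω) (fun j => x j ω)} = Set.univ from
    Set.union_compl_self _, measure_univ] at huniv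
  exact huniv.trans (by gcongr)
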